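/- All graphs are finite, simple and undirected, with at least one vertex; $\Delta(G)$ denotes the maximum degree of $G$. For $k\in\mathbb{N}$, a $k$-star colouring of a graph $G$ is a function $f\colon V(G)\to\{0,1,\dots,k-1\}$ such that adjacent vertices get different colours and there is no path $u,v,w,x$ on four vertices of $G$ with $f(u)=f(w)$ and $f(v)=f(x)$. The decision problem $k$-Star Colourability takes a graph $G$ as input and asks whether $G$ has a $k$-star colouring; we call it NP-complete for a class of graphs if its restriction to instances in that class is NP-complete (it is in NP, and every language in NP has a polynomial-time many-one reduction to it). **Theorem.** Let $k\geq 3$ and $0\le d\leq k-1$ be integers. Then: 1. $k$-Star Colourability is NP-complete for graphs $G$ with $\Delta(G)=d$ if and only if it is NP-complete for $d$-regular graphs. 2. $k$-Star Colourability is NP-complete for triangle-free graphs $G$ with $\Delta(G)=d$ if and only if it is NP-complete for triangle-free $d$-regular graphs. 3. $k$-Star Colourability is NP-complete for bipartite graphs $G$ with $\Delta(G)=d$ if and only if it is NP-complete for bipartite $d$-regular graphs. -/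

import Mathlib

/-! ## Star colouring -/

/-- A `k`-star colouring: a proper colouring with the `k` colours `Fin k` for which no path
`u, v, w, x` on four (distinct) vertices is bicoloured. -/
def IsStarColouring {V : Type*} {G : SimpleGraph V} {k : ℕ} (f : G.Coloring (Fin k)) : Prop :=
  ∀ u v w x : V, [u, v, w, x].Nodup → G.Adj u v → G.Adj v w → G.Adj w x →
    ¬ (f u = f w ∧ f v = f x)

/-- `G` admits a `k`-star colouring. -/
def IsStarColourable {V : Type*} (G : SimpleGraph V) (k : ℕ) : Prop :=
  ∃ f : G.Coloring (Fin k), IsStarColouring f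

/-! ## Decision problems, polynomial-time reductions, NP-completeness

Polynomial time is Mathlib's polynomial time on (multi-stack) Turing machines. -/

/-- A decision problem: a set of instances, an injective encoding of the instances as binary
strings, and the set of yes-instances. -/
structure DecisionProblem where
  /-- the instances -/
  Instance : Type
  /-- the encoding of the instances -/
  encode : Instance → List Bool
  /-- different instances have different encodings -/
  encode_injective : Function.Injective encode
  /-- the yes-instances -/
  Yes : Instance → Prop

namespace DecisionProblem

/-- The restriction of a decision problem to the instances that satisfy `C`. -/
def restrict (P : DecisionProblem) (C : P.Instance → Prop) : DecisionProblem where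
  Instance := {x : P.Instance // C x}
  encode x := P.encode x.1
  encode_injective := P.encode_injective.comp Subtype.val_injective
  Yes x := P.Yes x.1

/-- The membership problem of a language of binary strings. -/
def ofLanguage (L : Language Bool) : DecisionProblem where
  Instance := List Bool
  encode x := x
  encode_injective := Function.injective_id
  Yes x := x ∈ L

/-- The string `x#c`, where `#` is the extra symbol `none`, for an instance `x` and a
certificate `c`. -/
def encodeWithCertificate (P : DecisionProblem) (y : P.Instance × List Bool) :
    List (Option Bool) :=
  (P.encode y.1).map some ++ none :: y.2.map some

/-- Membership in NP: some polynomial-time verifier accepts an instance together with some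
certificate of polynomially bounded length if and only if the instance is a yes-instance. -/
def InNP (P : DecisionProblem) : Prop :=
  ∃ (p : Polynomial ℕ) (verify : P.Instance × List Bool → Bool),
    Nonempty (Turing.TM2ComputableInPolyTime P.encodeWithCertificate Computability.encodeBool
      verify) ∧
    ∀ x : P.Instance,
      P.Yes x ↔ ∃ c : List Bool, c.length ≤ p.eval (P.encode x).length ∧ verify (x, c) = true

/-- Polynomial-time many-one (Karp) reducibility. -/
def PolyReducesTo (P Q : DecisionProblem) : Prop :=
  ∃ f : P.Instance → Q.Instance,
    Nonempty (Turing.TM2ComputableInPolyTime P.encode Q.encode f) ∧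
    ∀ x : P.Instance, P.Yes x ↔ Q.Yes (f x)

/-- `P` is NP-hard: every language in NP reduces to it in polynomial time. -/
def NPHard (P : DecisionProblem) : Prop :=
  ∀ L : Language Bool, (ofLanguage L).InNP → (ofLanguage L).PolyReducesTo P

/-- `P` is NP-complete. -/
def NPComplete (P : DecisionProblem) : Prop :=
  P.InNP ∧ P.NPHard

end DecisionProblem

/-! ## Finite graphs as instances -/

/-- A finite simple undirected graph, with at least one vertex and with vertex set
`{0, …, n - 1}`. -/
structure FinGraph where
  /-- the number of vertices -/
  n : ℕ
  /-- there is at least one vertex -/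
  n_pos : 0 < n
  /-- the graph -/
  graph : SimpleGraph (Fin n)

namespace FinGraph

open Classical in
/-- The entries of the adjacency matrix, row by row. -/
noncomputable def adjBits (G : FinGraph) : List Bool :=
  (List.finRange G.n).flatMap fun i => (List.finRange G.n).map fun j => decide (G.graph.Adj i j)

/-- The encoding of a graph: its number of vertices in unary, then its adjacency matrix. -/
noncomputable def encode (G : FinGraph) : List Bool :=
  List.replicate G.n true ++ false :: G.adjBits

theorem adjBits_injective {n : ℕ} (h : 0 < n) :
    Function.Injective fun G : SimpleGraph (Fin n) => adjBits ⟨n, h, G⟩ := by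
  classical
  intro G H hGH
  have key : ∀ (l : List (Fin n)) (r s : Fin n → List Bool),
      (∀ i, (r i).length = (s i).length) → l.flatMap r = l.flatMap s → ∀ i ∈ l, r i = s i := by
    intro l r s hl
    induction l with
    | nil => simp
    | cons a l ih =>
      intro h
      simp only [List.flatMap_cons] at h
      obtain ⟨h1, h2⟩ := List.append_inj h (hl a)
      intro i hi
      rcases List.mem_cons.1 hi with rfl | hi
      · exact h1
      · exact ih h2 i hi
  have hrow := key _ _ _ (by intro i; simp) hGH
  ext i j
  have h3 := List.map_inj_left.1 (hrow i (List.mem_finRange i)) j (List.mem_finRange j)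
  simpa using h3

theorem encode_injective : Function.Injective encode := by
  have key : ∀ (m n : ℕ) (s t : List Bool),
      List.replicate m true ++ false :: s = List.replicate n true ++ false :: t →
        m = n ∧ s = t := by
    intro m
    induction m with
    | zero =>
      intro n s t h
      cases n with
      | zero => simpa using h
      | succ n => simp [List.replicate_succ] at h
    | succ m ih =>
      intro n s t h
      cases n with
      | zero => simp [List.replicate_succ] at h
      | succ n =>
        simp only [List.replicate_succ, List.cons_append, List.cons.injEq, true_and] at h
        obtain ⟨h1, h2⟩ := ih n s t h
        exact ⟨by rw [h1], h2⟩
  rintro ⟨m, hm, G⟩ ⟨n, hn, H⟩ h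
  obtain ⟨h1, h2⟩ := key _ _ _ _ h
  change m = n at h1
  subst h1
  have h3 : G = H := adjBits_injective hm h2
  rw [h3]

open Classical in
/-- `Δ(G) = d`. -/
def HasMaxDegree (d : ℕ) (G : FinGraph) : Prop :=
  G.graph.maxDegree = d

open Classical in
/-- `G` is `d`-regular. -/
def IsRegular (d : ℕ) (G : FinGraph) : Prop :=
  G.graph.IsRegularOfDegree d

/-- `G` has no triangle. -/
def IsTriangleFree (G : FinGraph) : Prop :=
  G.graph.CliqueFree 3

/-- `G` is bipartite. -/
def IsBipartite (G : FinGraph) : Prop :=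
  G.graph.IsBipartite

end FinGraph

/-- The decision problem `k`-Star Colourability: given a graph, is it `k`-star colourable? -/
noncomputable def StarColourability (k : ℕ) : DecisionProblem where
  Instance := FinGraph
  encode := FinGraph.encode
  encode_injective := FinGraph.encode_injective
  Yes G := IsStarColourable G.graph k

namespace Turing.TM2

/-! ### Step counts and stack growth -/

section Steps

variable {K : Type*} [DecidableEq K] {Γ : K → Type*} {Λ σ : Type*}

/-- `c'` is reached from `c` in exactly `n` steps of `M`. -/
def StepsIn (M : Λ → Stmt Γ Λ σ) (n : ℕ) (c c' : Cfg Γ Λ σ) : Prop :=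
  (flip bind (step M))^[n] (some c) = some c'

variable {M : Λ → Stmt Γ Λ σ}

theorem StepsIn.refl (c : Cfg Γ Λ σ) : StepsIn M 0 c c := rfl

theorem StepsIn.trans {m n : ℕ} {a b c : Cfg Γ Λ σ} (h₁ : StepsIn M m a b)
    (h₂ : StepsIn M n b c) : StepsIn M (m + n) a c := by
  unfold StepsIn at *
  rw [add_comm, Function.iterate_add_apply, h₁, h₂]

theorem stepsIn_succ_some {n : ℕ} {l : Λ} {v : σ} {S : ∀ k, List (Γ k)} {c : Cfg Γ Λ σ} :
    StepsIn M (n + 1) ⟨some l, v, S⟩ c ↔ StepsIn M n (stepAux (M l) v S) c := by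
  rw [StepsIn, Function.iterate_succ_apply]
  rfl

theorem StepsIn.head {n : ℕ} {l : Λ} {v : σ} {S : ∀ k, List (Γ k)} {c : Cfg Γ Λ σ}
    (h : StepsIn M n (stepAux (M l) v S) c) : StepsIn M (n + 1) ⟨some l, v, S⟩ c :=
  stepsIn_succ_some.2 h

theorem iterate_flip_bind_none {α : Type*} (f : α → Option α) (n : ℕ) :
    (flip bind f)^[n] none = none := by
  induction n with
  | zero => rfl
  | succ n ih => rw [Function.iterate_succ_apply]; exact ih

theorem stepsIn_none {n : ℕ} {v : σ} {S : ∀ k, List (Γ k)} {c : Cfg Γ Λ σ}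
    (h : StepsIn M n ⟨none, v, S⟩ c) : n = 0 ∧ c = ⟨none, v, S⟩ := by
  cases n with
  | zero => exact ⟨rfl, (Option.some.inj h).symm⟩
  | succ n =>
    rw [StepsIn, Function.iterate_succ_apply] at h
    have : flip bind (step M) (some (⟨none, v, S⟩ : Cfg Γ Λ σ)) = none := rfl
    rw [this, iterate_flip_bind_none] at h
    cases h

/-- An upper bound for the number of push operations in a single execution of a statement. -/
def Stmt.pushes : Stmt Γ Λ σ → ℕ
  | .push _ _ q => q.pushes + 1
  | .peek _ _ q => q.pushes
  | .pop _ _ q => q.pushes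
  | .load _ q => q.pushes
  | .branch _ q₁ q₂ => q₁.pushes + q₂.pushes
  | .goto _ => 0
  | .halt => 0

theorem length_stk_stepAux_le (q : Stmt Γ Λ σ) (v : σ) (S : ∀ k, List (Γ k)) (k : K) :
    ((stepAux q v S).stk k).length ≤ (S k).length + q.pushes := by
  induction q generalizing v S with
  | push k' f q ih =>
    refine (ih _ _).trans ?_
    by_cases h : k = k'
    · subst h; simp [Stmt.pushes]; omega
    · simp [Function.update_of_ne h, Stmt.pushes]
  | pop k' f q ih =>
    refine (ih _ _).trans ?_
    by_cases h : k = k'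
    · subst h; simp [Stmt.pushes]
    · simp [Function.update_of_ne h, Stmt.pushes]
  | peek k' f q ih => exact ih _ _
  | load f q ih => exact ih _ _
  | branch f q₁ q₂ ih₁ ih₂ =>
    simp only [stepAux, Stmt.pushes]
    cases f v
    · exact (ih₂ _ _).trans (by omega)
    · exact (ih₁ _ _).trans (by omega)
  | goto f => simp [Stmt.pushes]
  | halt => simp [Stmt.pushes]

theorem StepsIn.length_stk_le {C : ℕ} (hC : ∀ l, (M l).pushes ≤ C) {n : ℕ} {c c' : Cfg Γ Λ σ}
    (h : StepsIn M n c c') (k : K) : (c'.stk k).length ≤ (c.stk k).length + C * n := by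
  induction n generalizing c with
  | zero => cases h; simp
  | succ n ih =>
    obtain ⟨_ | l, v, S⟩ := c
    · exact absurd (stepsIn_none h).1 (by simp)
    · have h1 := ih (stepsIn_succ_some.1 h)
      have h2 := length_stk_stepAux_le (M l) v S k
      have h3 := hC l
      rw [mul_add]
      simp only
      omega

end Steps

/-! ### Simulation inside a larger machine -/

section Embedding

variable {K K' : Type*} [DecidableEq K] [DecidableEq K'] {Γ : K → Type*} {Γ' : K' → Type*}
  {Λ Λ' σ σ' : Type*}

/-- The statement that performs `q` on the stacks `j k` of a larger machine, with labels and
internal states embedded in larger sets, and that performs `exit` instead of halting. -/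
def Stmt.embed (j : K → K') (e : ∀ k, Γ k ≃ Γ' (j k)) (s : σ → σ') (r : σ' → σ) (t : Λ → Λ')
    (exit : Stmt Γ' Λ' σ') : Stmt Γ Λ σ → Stmt Γ' Λ' σ'
  | .push k f q => .push (j k) (fun v => e k (f (r v))) (embed j e s r t exit q)
  | .peek k f q =>
    .peek (j k) (fun v o => s (f (r v) (o.map (e k).symm))) (embed j e s r t exit q)
  | .pop k f q =>
    .pop (j k) (fun v o => s (f (r v) (o.map (e k).symm))) (embed j e s r t exit q)
  | .load f q => .load (fun v => s (f (r v))) (embed j e s r t exit q)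
  | .branch f q₁ q₂ =>
    .branch (fun v => f (r v)) (embed j e s r t exit q₁) (embed j e s r t exit q₂)
  | .goto f => .goto fun v => t (f (r v))
  | .halt => exit

/-- The stacks `j k` of the larger machine agree with those of the smaller one, and the other
stacks are empty. -/
def StkEmbeds (j : K → K') (e : ∀ k, Γ k ≃ Γ' (j k)) (S : ∀ k, List (Γ k))
    (S' : ∀ k, List (Γ' k)) : Prop :=
  (∀ k, S' (j k) = (S k).map (e k)) ∧ ∀ k', k' ∉ Set.range j → S' k' = []

variable {j : K → K'} {e : ∀ k, Γ k ≃ Γ' (j k)} {s : σ → σ'} {r : σ' → σ} {t : Λ → Λ'}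
  {exit : Stmt Γ' Λ' σ'}

theorem StkEmbeds.update (hj : Function.Injective j) {S : ∀ k, List (Γ k)}
    {S' : ∀ k, List (Γ' k)} (h : StkEmbeds j e S S') (k : K) (x : List (Γ k)) :
    StkEmbeds j e (Function.update S k x) (Function.update S' (j k) (x.map (e k))) := by
  refine ⟨fun k₂ => ?_, fun k' hk' => ?_⟩
  · by_cases hk : k₂ = k
    · subst hk; simp
    · rw [Function.update_of_ne hk, Function.update_of_ne (hj.ne hk), h.1]
  · rw [Function.update_of_ne (by rintro rfl; exact hk' ⟨k, rfl⟩), h.2 k' hk']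

/-- The simulation is step for step. Since `exit` stands in the place of `halt`, it is executed
within the last simulated step, which is why the halting case ends in `stepAux exit` and not in a
configuration with a label. -/
theorem stepAux_embed (hj : Function.Injective j) (hr : ∀ v, r (s v) = v) (q : Stmt Γ Λ σ) (v : σ)
    (S : ∀ k, List (Γ k)) (S' : ∀ k, List (Γ' k)) (h : StkEmbeds j e S S') :
    ∃ T', StkEmbeds j e (stepAux q v S).stk T' ∧
      stepAux (Stmt.embed j e s r t exit q) (s v) S' =
        match (stepAux q v S).l with
        | some l => ⟨some (t l), s (stepAux q v S).var, T'⟩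
        | none => stepAux exit (s (stepAux q v S).var) T' := by
  induction q generalizing v S S' with
  | push k f q ih =>
    simp only [Stmt.embed, stepAux, hr]
    refine ih _ _ _ ?_
    have := h.update hj k (f v :: S k)
    rwa [List.map_cons, ← h.1] at this
  | peek k f q ih =>
    simp only [Stmt.embed, stepAux, hr, h.1, List.head?_map, Option.map_map,
      Equiv.symm_comp_self, Option.map_id_fun, id]
    exact ih _ _ _ h
  | pop k f q ih =>
    simp only [Stmt.embed, stepAux, hr, h.1, List.head?_map, Option.map_map,
      Equiv.symm_comp_self, Option.map_id_fun, id]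
    refine ih _ _ _ ?_
    have := h.update hj k (S k).tail
    rwa [List.map_tail] at this
  | load f q ih =>
    simp only [Stmt.embed, stepAux, hr]
    exact ih _ _ _ h
  | branch f q₁ q₂ ih₁ ih₂ =>
    simp only [Stmt.embed, stepAux, hr]
    cases f v
    · exact ih₂ _ _ _ h
    · exact ih₁ _ _ _ h
  | goto f => exact ⟨S', h, by simp [Stmt.embed, hr]⟩
  | halt => exact ⟨S', h, by simp [Stmt.embed]⟩

theorem StepsIn.embed (hj : Function.Injective j) (hr : ∀ v, r (s v) = v) {M : Λ → Stmt Γ Λ σ}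
    {M' : Λ' → Stmt Γ' Λ' σ'} (hM : ∀ l, M' (t l) = Stmt.embed j e s r t exit (M l)) {n : ℕ} {l : Λ}
    {v v' : σ} {S T : ∀ k, List (Γ k)} {S' : ∀ k, List (Γ' k)} (hS : StkEmbeds j e S S')
    (h : StepsIn M n ⟨some l, v, S⟩ ⟨none, v', T⟩) :
    ∃ T', StkEmbeds j e T T' ∧
      StepsIn M' n ⟨some (t l), s v, S'⟩ (stepAux exit (s v') T') := by
  induction n generalizing l v S S' with
  | zero => cases h
  | succ n ih =>
    rw [stepsIn_succ_some] at h
    obtain ⟨U', hU, hU'⟩ := stepAux_embed (t := t) (exit := exit) hj hr (M l) v S S' hS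
    rcases hc : stepAux (M l) v S with ⟨_ | l₂, v₂, U⟩
    · rw [hc] at h hU hU'
      obtain ⟨rfl, h2⟩ := stepsIn_none h
      cases h2
      refine ⟨U', hU, StepsIn.head ?_⟩
      rw [hM, hU']
      rfl
    · rw [hc] at h hU hU'
      obtain ⟨T', hT, hT'⟩ := ih hU h
      refine ⟨T', hT, StepsIn.head ?_⟩
      rw [hM, hU']
      exact hT'

end Embedding

end Turing.TM2

/-! ### Output length of a polynomial-time machine -/

namespace Turing

theorem initList_eq (tm : FinTM2) (s : List (tm.Γ tm.k₀)) :
    initList tm s = ⟨some tm.main, tm.initialState, Function.update (fun _ => []) tm.k₀ s⟩ := by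
  unfold initList
  congr 1
  funext k
  by_cases h : k = tm.k₀
  · subst h; simp
  · simp [h]

theorem haltList_eq (tm : FinTM2) (s : List (tm.Γ tm.k₁)) :
    haltList tm s = ⟨none, tm.initialState, Function.update (fun _ => []) tm.k₁ s⟩ := by
  unfold haltList
  congr 1
  funext k
  by_cases h : k = tm.k₁
  · subst h; simp
  · simp [h]

theorem monotone_eval_polynomial (p : Polynomial ℕ) : Monotone fun n : ℕ => p.eval n := by
  intro m n h
  simp only [Polynomial.eval_eq_sum, Polynomial.sum]
  gcongr

namespace TM2ComputableInPolyTime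

variable {α β γ αΓ βΓ γΓ : Type} {eα : α → List αΓ} {eβ : β → List βΓ} {eγ : γ → List γΓ}
  {f : α → β} {g : β → γ}

theorem exists_stepsIn (h : TM2ComputableInPolyTime eα eβ f) (a : α) :
    ∃ n ≤ h.time.eval (eα a).length, TM2.StepsIn h.tm.m n
      ⟨some h.tm.main, h.tm.initialState,
        Function.update (fun _ => []) h.tm.k₀ ((eα a).map h.inputAlphabet.symm)⟩
      ⟨none, h.tm.initialState,
        Function.update (fun _ => []) h.tm.k₁ ((eβ (f a)).map h.outputAlphabet.symm)⟩ := by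
  obtain ⟨⟨n, h₁⟩, hn⟩ := h.outputsFun a
  rw [initList_eq, Option.map_some, haltList_eq] at h₁
  exact ⟨n, hn, h₁⟩

/-- A step lengthens a stack by at most the number of pushes in its statement, so the output is no
longer than the input plus a constant times the running time. -/
theorem exists_length_le (h : TM2ComputableInPolyTime eα eβ f) :
    ∃ p : Polynomial ℕ, ∀ a, (eβ (f a)).length ≤ p.eval (eα a).length := by
  have := h.tm.ΛFin
  set C := ∑ l : h.tm.Λ, (h.tm.m l).pushes
  refine ⟨Polynomial.X + Polynomial.C C * h.time, fun a => ?_⟩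
  obtain ⟨n, hn, hs⟩ := h.exists_stepsIn a
  have h1 := hs.length_stk_le (C := C)
    (fun l => Finset.single_le_sum (f := fun l => (h.tm.m l).pushes) (fun _ _ => Nat.zero_le _)
      (Finset.mem_univ l)) h.tm.k₁
  simp only [Function.update_self, List.length_map] at h1
  refine h1.trans ?_
  simp only [Polynomial.eval_add, Polynomial.eval_X, Polynomial.eval_mul, Polynomial.eval_C]
  refine Nat.add_le_add ?_ (Nat.mul_le_mul_left _ hn)
  by_cases hk : h.tm.k₁ = h.tm.k₀
  · rw [hk]; simp
  · simp [Function.update_of_ne hk]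

end TM2ComputableInPolyTime

end Turing

/-! ### Composition of polynomial-time functions -/

namespace Turing

namespace TM2

section Move

variable {K : Type*} [DecidableEq K] {Γ : K → Type*} {Λ σ : Type*} {X : Type*}

/-- The loop that moves the content of the stack `p` to the stack `q`, translating the symbols via
`X`, and then performs `next`. The symbol that is moved is part of the internal state. -/
def Stmt.move (p q : K) (a : Γ p → X) (b : X → Γ q) (x₀ : X) (get : σ → Option X)
    (put : σ → Option X → σ) (l : Λ) (next : Stmt Γ Λ σ) : Stmt Γ Λ σ :=
  .pop p (fun v o => put v (o.map a)) <|
    .branch (fun v => (get v).isSome)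
      (.push q (fun v => b ((get v).getD x₀)) <| .goto fun _ => l) next

/-- One step per symbol, and one more in which the pop finds the stack empty and `next` is executed.
Moving reverses the order. -/
theorem stepsIn_move {M : Λ → Stmt Γ Λ σ} {p q : K} (hpq : p ≠ q) {a : Γ p → X} {b : X → Γ q}
    {x₀ : X} {get : σ → Option X} {put : σ → Option X → σ} (hget : ∀ v o, get (put v o) = o)
    (hput : ∀ v o o', put (put v o) o' = put v o') {l : Λ} {next : Stmt Γ Λ σ}
    (hM : M l = Stmt.move p q a b x₀ get put l next) {n : ℕ} {c : Cfg Γ Λ σ} (s : List (Γ p))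
    (v : σ) (S : ∀ k, List (Γ k)) (hs : S p = s)
    (h : StepsIn M n (stepAux next (put v none)
      (Function.update (Function.update S p []) q ((s.map fun x => b (a x)).reverse ++ S q))) c) :
    StepsIn M (s.length + 1 + n) ⟨some l, v, S⟩ c := by
  rw [Nat.add_right_comm]
  induction s generalizing v S with
  | nil =>
    refine StepsIn.head ?_
    have e := Function.update_eq_self q (Function.update S p [])
    rw [Function.update_of_ne hpq.symm] at e
    rw [hM]
    simpa [Stmt.move, hs, hget, e] using h
  | cons x s ih =>
    refine StepsIn.head ?_
    rw [hM]
    simp only [Stmt.move, stepAux, hs, hget, List.head?_cons, Option.map_some, List.tail_cons,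
      Option.isSome_some, cond_true, Option.getD_some, List.length_cons,
      Function.update_of_ne hpq.symm]
    rw [Nat.add_right_comm, add_comm s.length n, ← add_comm s.length n]
    refine ih _ _ ?_ ?_
    · rw [Function.update_of_ne hpq, Function.update_self]
    · rw [hput, Function.update_self, Function.update_comm hpq.symm, Function.update_idem,
        Function.update_idem]
      simpa using h

end Move

end TM2

section Comp

open TM2

variable {K₁ K₂ K : Type*} [DecidableEq K₁] [DecidableEq K₂] [DecidableEq K] {Γ₁ : K₁ → Type*}
  {Γ₂ : K₂ → Type*} {Γ : K → Type*} {Λ₁ Λ₂ σ₁ σ₂ : Type*} {j₁ : K₁ → K} {j₂ : K₂ → K} {p : K}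

/-- The most recently transferred symbol. -/
def compSymbol {X : Type*} : σ₁ ⊕ Option X ⊕ σ₂ → Option X
  | .inr (.inl o) => o
  | _ => none

/-- The program that performs `M₁`, then moves the stack `j₁ k₁` to `j₂ k₂` via the stack `p`,
and then performs `M₂`. -/
def compProgram (e₁ : ∀ k, Γ₁ k ≃ Γ (j₁ k)) (e₂ : ∀ k, Γ₂ k ≃ Γ (j₂ k)) (k₁ : K₁) (k₂ : K₂)
    (a : Γ (j₁ k₁) → Γ p) (b : Γ p → Γ (j₂ k₂)) (x₀ : Γ p) (v₁ : σ₁) (v₂ : σ₂) (l₂ : Λ₂)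
    (M₁ : Λ₁ → Stmt Γ₁ Λ₁ σ₁) (M₂ : Λ₂ → Stmt Γ₂ Λ₂ σ₂) :
    Λ₁ ⊕ Bool ⊕ Λ₂ → Stmt Γ (Λ₁ ⊕ Bool ⊕ Λ₂) (σ₁ ⊕ Option (Γ p) ⊕ σ₂)
  | .inl l =>
    Stmt.embed j₁ e₁ .inl (Sum.elim id fun _ => v₁) .inl (.goto fun _ => .inr (.inl false)) (M₁ l)
  | .inr (.inl false) =>
    Stmt.move (j₁ k₁) p a id x₀ compSymbol (fun _ o => .inr (.inl o)) (.inr (.inl false))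
      (.goto fun _ => .inr (.inl true))
  | .inr (.inl true) =>
    Stmt.move p (j₂ k₂) id b x₀ compSymbol (fun _ o => .inr (.inl o)) (.inr (.inl true))
      (.load (fun _ => .inr (.inr v₂)) <| .goto fun _ => .inr (.inr l₂))
  | .inr (.inr l) =>
    Stmt.embed j₂ e₂ (fun v => .inr (.inr v)) (Sum.elim (fun _ => v₂) (Sum.elim (fun _ => v₂) id))
      (fun l => .inr (.inr l)) (.load (fun _ => .inl v₁) .halt) (M₂ l)

/-- The auxiliary stack `p` is there because a single move would reverse the word. When `M₁` stops,
only its output stack is nonempty, so after both moves `M₂` finds the stacks of a fresh start. The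
final reset of the state to `v₁` is required of a halting configuration. -/
theorem stepsIn_compProgram {e₁ : ∀ k, Γ₁ k ≃ Γ (j₁ k)} {e₂ : ∀ k, Γ₂ k ≃ Γ (j₂ k)}
    {k₁ : K₁} {k₂ : K₂} {a : Γ (j₁ k₁) → Γ p} {b : Γ p → Γ (j₂ k₂)} {x₀ : Γ p} {v₁ : σ₁} {v₂ : σ₂}
    {l₁ : Λ₁} {l₂ : Λ₂} {M₁ : Λ₁ → Stmt Γ₁ Λ₁ σ₁} {M₂ : Λ₂ → Stmt Γ₂ Λ₂ σ₂}
    (hj₁ : Function.Injective j₁) (hj₂ : Function.Injective j₂) (hj : ∀ x y, j₁ x ≠ j₂ y)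
    (hp₁ : ∀ x, j₁ x ≠ p) (hp₂ : ∀ x, j₂ x ≠ p) {ι : Γ₁ k₁ → Γ₂ k₂}
    (hι : ∀ x, b (a (e₁ k₁ x)) = e₂ k₂ (ι x)) {m n : ℕ} {S₁ : ∀ k, List (Γ₁ k)}
    {S₂ : ∀ k, List (Γ₂ k)} {S : ∀ k, List (Γ k)} {y : List (Γ₁ k₁)} {v₁' : σ₁} {v₂' : σ₂}
    (hS : StkEmbeds j₁ e₁ S₁ S)
    (h₁ : StepsIn M₁ m ⟨some l₁, v₁, S₁⟩ ⟨none, v₁', Function.update (fun _ => []) k₁ y⟩)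
    (h₂ : StepsIn M₂ n ⟨some l₂, v₂, Function.update (fun _ => []) k₂ (y.map ι)⟩ ⟨none, v₂', S₂⟩) :
    ∃ T, StkEmbeds j₂ e₂ S₂ T ∧
      StepsIn (compProgram e₁ e₂ k₁ k₂ a b x₀ v₁ v₂ l₂ M₁ M₂)
        (m + (y.length + 1 + (y.length + 1 + n))) ⟨some (.inl l₁), .inl v₁, S⟩
        ⟨none, .inl v₁, T⟩ := by
  set M := compProgram e₁ e₂ k₁ k₂ a b x₀ v₁ v₂ l₂ M₁ M₂
  obtain ⟨T, ⟨hT, hT'⟩, H₁⟩ := StepsIn.embed (M' := M) (s := Sum.inl)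
    (r := Sum.elim id fun _ => v₁) (t := Sum.inl) (exit := .goto fun _ => .inr (.inl false)) hj₁
    (fun _ => rfl) (fun _ => rfl) hS h₁
  have hTk : T (j₁ k₁) = y.map (e₁ k₁) := by rw [hT, Function.update_self]
  have hT₀ : ∀ k, k ≠ j₁ k₁ → T k = [] := by
    intro k hk
    by_cases hr : k ∈ Set.range j₁
    · obtain ⟨k, rfl⟩ := hr
      rw [hT, Function.update_of_ne (by rintro rfl; exact hk rfl), List.map_nil]
    · exact hT' k hr
  obtain ⟨U, hU, H₂⟩ := StepsIn.embed (M' := M) (s := fun v => .inr (.inr v))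
    (r := Sum.elim (fun _ => v₂) (Sum.elim (fun _ => v₂) id)) (t := fun l => .inr (.inr l))
    (exit := .load (fun _ => .inl v₁) .halt)
    (S' := Function.update (fun _ => []) (j₂ k₂) ((y.map ι).map (e₂ k₂))) hj₂ (fun _ => rfl)
    (fun _ => rfl)
    (StkEmbeds.update hj₂ (S' := fun _ => []) ⟨fun _ => rfl, fun _ _ => rfl⟩ k₂ (y.map ι)) h₂
  refine ⟨U, hU, H₁.trans ?_⟩
  have e₃ : (y.map ι).map (e₂ k₂) = ((y.map (e₁ k₁)).map a).map b := by
    simp [Function.comp_def, hι]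
  rw [← List.length_map (e₁ k₁)]
  refine stepsIn_move (X := Γ p) (get := compSymbol) (put := fun _ o => .inr (.inl o)) (hp₁ k₁)
    (fun _ _ => rfl) (fun _ _ _ => rfl) rfl _ _ _ hTk ?_
  rw [← List.length_map a, ← List.length_reverse]
  refine stepsIn_move (X := Γ p) (get := compSymbol) (put := fun _ o => .inr (.inl o))
    (hp₂ k₂).symm (fun _ _ => rfl) (fun _ _ _ => rfl) rfl _ _ _ ?_ ?_
  · rw [Function.update_self, hT₀ p (hp₁ k₁).symm]
    simp
  · simp only [stepAux] at H₂ ⊢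
    convert H₂ using 2
    funext k
    by_cases hk₂ : k = j₂ k₂
    · subst hk₂
      rw [Function.update_self, Function.update_self, e₃, Function.update_of_ne (hp₂ k₂),
        Function.update_of_ne (hj _ _).symm,
        hT₀ _ (hj _ _).symm]
      simp
    rw [Function.update_of_ne hk₂, Function.update_of_ne hk₂]
    by_cases hk : k = p
    · subst hk
      rw [Function.update_self]
    rw [Function.update_of_ne hk, Function.update_of_ne hk]
    by_cases hk₁ : k = j₁ k₁
    · subst hk₁
      rw [Function.update_self]
    rw [Function.update_of_ne hk₁, hT₀ k hk₁]

end Comp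

/-- The machine that runs `tm₁`, then moves the output of `tm₁` to the input stack of `tm₂`, and
then runs `tm₂`. -/
def compMachine (tm₁ tm₂ : FinTM2) (ι : tm₁.Γ tm₁.k₁ ≃ tm₂.Γ tm₂.k₀) (x₀ : tm₂.Γ tm₂.k₀) :
    FinTM2 :=
  letI := tm₁.kFin
  letI := tm₂.kFin
  letI := tm₁.ΛFin
  letI := tm₂.ΛFin
  letI := tm₁.σFin
  letI := tm₂.σFin
  letI := tm₂.Γk₀Fin
  { K := tm₁.K ⊕ Unit ⊕ tm₂.K
    k₀ := .inl tm₁.k₀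
    k₁ := .inr (.inr tm₂.k₁)
    Γ := Sum.elim tm₁.Γ (Sum.elim (fun _ => tm₂.Γ tm₂.k₀) tm₂.Γ)
    Λ := tm₁.Λ ⊕ Bool ⊕ tm₂.Λ
    main := .inl tm₁.main
    σ := tm₁.σ ⊕ Option (tm₂.Γ tm₂.k₀) ⊕ tm₂.σ
    initialState := .inl tm₁.initialState
    Γk₀Fin := tm₁.Γk₀Fin
    m := compProgram (Γ := Sum.elim tm₁.Γ (Sum.elim (fun _ => tm₂.Γ tm₂.k₀) tm₂.Γ)) (j₁ := .inl)
      (j₂ := fun k => .inr (.inr k)) (p := .inr (.inl ())) (fun _ => Equiv.refl _)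
      (fun _ => Equiv.refl _) tm₁.k₁ tm₂.k₀ ι id x₀ tm₁.initialState tm₂.initialState tm₂.main
      tm₁.m tm₂.m }

theorem StkEmbeds.update_nil {K K' : Type*} [DecidableEq K] [DecidableEq K'] {Γ : K → Type*}
    {Γ' : K' → Type*} {j : K → K'} {e : ∀ k, Γ k ≃ Γ' (j k)} (hj : Function.Injective j) (k : K)
    (x : List (Γ k)) {T : ∀ k, List (Γ' k)} :
    TM2.StkEmbeds j e (Function.update (fun _ => []) k x) T ↔
      T = Function.update (fun _ => []) (j k) (x.map (e k)) := by
  have h : TM2.StkEmbeds j e (Function.update (fun _ => []) k x) (Function.update (fun _ => [])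
      (j k) (x.map (e k))) :=
    TM2.StkEmbeds.update hj (S' := fun _ => []) ⟨fun _ => rfl, fun _ _ => rfl⟩ k x
  refine ⟨fun hT => ?_, fun hT => hT ▸ h⟩
  funext k'
  by_cases hr : k' ∈ Set.range j
  · obtain ⟨k', rfl⟩ := hr
    rw [hT.1, h.1]
  · rw [hT.2 _ hr, h.2 _ hr]

/-- The composition of two polynomial-time computable functions is polynomial-time computable. -/
theorem TM2ComputableInPolyTime.nonempty_comp {α β γ αΓ βΓ γΓ : Type} [Inhabited βΓ]
    {eα : α → List αΓ} {eβ : β → List βΓ} {eγ : γ → List γΓ} {f : α → β} {g : β → γ}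
    (h₁ : TM2ComputableInPolyTime eα eβ f) (h₂ : TM2ComputableInPolyTime eβ eγ g) :
    Nonempty (TM2ComputableInPolyTime eα eγ (g ∘ f)) := by
  obtain ⟨p, hp⟩ := h₁.exists_length_le
  set ι := h₁.outputAlphabet.trans h₂.inputAlphabet.symm with hι
  -- The polynomial `p` bounds the length of the intermediate word: each of the two moves takes at
  -- most `p + 1` steps, and the second machine runs on an input of length at most `p`.
  refine ⟨⟨⟨compMachine h₁.tm h₂.tm ι (h₂.inputAlphabet.symm default), h₁.inputAlphabet,
    h₂.outputAlphabet⟩, h₁.time + (p + 1) + (p + 1) + h₂.time.comp p, fun a => ?_⟩⟩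
  refine Classical.choice ?_
  obtain ⟨n₁, hn₁, H₁⟩ := h₁.exists_stepsIn a
  obtain ⟨n₂, hn₂, H₂⟩ := h₂.exists_stepsIn (f a)
  have e : (eβ (f a)).map h₂.inputAlphabet.symm
      = ((eβ (f a)).map h₁.outputAlphabet.symm).map ι := by
    simp [hι, Function.comp_def]
  obtain ⟨y, hy⟩ : ∃ y, y = (eβ (f a)).map h₁.outputAlphabet.symm := ⟨_, rfl⟩
  have hl : y.length = (eβ (f a)).length := by rw [hy, List.length_map]
  rw [e, ← hy] at H₂
  rw [← hy] at H₁
  obtain ⟨T, hT, H⟩ := stepsIn_compProgram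
    (Γ := Sum.elim h₁.tm.Γ (Sum.elim (fun _ => h₂.tm.Γ h₂.tm.k₀) h₂.tm.Γ)) (j₁ := .inl)
    (j₂ := fun k => .inr (.inr k)) (p := .inr (.inl ())) (e₁ := fun _ => Equiv.refl _)
    (e₂ := fun _ => Equiv.refl _) (a := ι) (b := id) (x₀ := h₂.inputAlphabet.symm default)
    Sum.inl_injective (Sum.inr_injective.comp Sum.inr_injective) (by simp) (by simp) (by simp)
    (fun _ => rfl) ((StkEmbeds.update_nil Sum.inl_injective _ _).2 rfl) H₁ H₂
  have hT := (StkEmbeds.update_nil (Sum.inr_injective.comp Sum.inr_injective) _ _).1 hT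
  subst hT
  unfold TM2OutputsInTime
  rw [initList_eq, Option.map_some, haltList_eq]
  have i₁ : (List.map h₁.inputAlphabet.symm (eα a)).map (Equiv.refl (h₁.tm.Γ h₁.tm.k₀)) =
    List.map h₁.inputAlphabet.symm (eα a) := List.map_id _
  have i₂ : (List.map h₂.outputAlphabet.symm (eγ (g (f a)))).map
      (Equiv.refl (h₂.tm.Γ h₂.tm.k₁)) = List.map h₂.outputAlphabet.symm (eγ (g (f a))) :=
    List.map_id _
  erw [i₁, i₂] at H
  refine ⟨⟨⟨_, H⟩, ?_⟩⟩
  change n₁ + (y.length + 1 + (y.length + 1 + n₂)) ≤ _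
  have hb := hp a
  have hm := monotone_eval_polynomial h₂.time hb
  simp only [Polynomial.eval_add, Polynomial.eval_one, Polynomial.eval_comp]
  simp only at hm
  omega

end Turing

/-! ### The machine that expands an adjacency matrix -/

namespace Turing

namespace TM2

variable {K : Type*} [DecidableEq K] {Γ : K → Type*} {Λ σ : Type*}

/-- The statement that pushes the symbols in a list, and then performs `q`. -/
def Stmt.pushList (k : K) (l : List (σ → Γ k)) (q : Stmt Γ Λ σ) : Stmt Γ Λ σ :=
  l.foldr (fun f q => .push k f q) q

theorem stepAux_pushList (k : K) (l : List (σ → Γ k)) (q : Stmt Γ Λ σ) (v : σ)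
    (S : ∀ k, List (Γ k)) :
    stepAux (Stmt.pushList k l q) v S =
      stepAux q v (Function.update S k ((l.map fun f => f v).reverse ++ S k)) := by
  induction l generalizing S with
  | nil => simp [Stmt.pushList]
  | cons f l ih =>
    simp only [Stmt.pushList, List.foldr_cons, stepAux] at ih ⊢
    rw [ih]
    simp

end TM2

/-- The stacks of the expansion machine: input and output, the input matrix, the current row, and
a stack to reverse the current row. -/
inductive ExpandStack
  | io | mat | cur | rev
  deriving DecidableEq

instance : Fintype ExpandStack := ⟨{.io, .mat, .cur, .rev}, by rintro ⟨⟩ <;> decide⟩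

/-- The labels of the expansion machine. -/
inductive ExpandLabel
  | readSize | readMatrix | row | back | emit | restore | finish
  deriving DecidableEq

instance : Fintype ExpandLabel :=
  ⟨{.readSize, .readMatrix, .row, .back, .emit, .restore, .finish}, by rintro ⟨⟩ <;> decide⟩

/-- The stack alphabets of the expansion machine. The entries of the current row consist of a
bit that tells whether the vertex is a vertex of the input, of the bit of the row, and of a mark for
the diagonal entry. -/
abbrev ExpandAlphabet (A : Type) : ExpandStack → Type
  | .io => A
  | .mat => Bool
  | .cur => Bool × Bool × Bool
  | .rev => Bool × Bool × Bool

/-- The internal states of the expansion machine. -/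
structure ExpandState (A : Type) (D m : ℕ) where
  /-- the last symbol from `io` -/
  symbol : Option A
  /-- the last symbol from `mat` -/
  bit : Option Bool
  /-- the last symbol from `cur` or `rev` -/
  entry : Option (Bool × Bool × Bool)
  /-- whether the next entry of the current row is the diagonal entry -/
  carry : Bool
  /-- whether the diagonal entry of the current row has been found at an additional vertex -/
  seen : Bool
  /-- the number of ones in the current row -/
  deg : Fin (D + 1)
  /-- the number of the output row among those that belong to the current row -/
  idx : Fin (m + 1)

noncomputable instance (A : Type) [Fintype A] (D m : ℕ) : Fintype (ExpandState A D m) :=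
  Fintype.ofInjective (fun v => (v.symbol, v.bit, v.entry, v.carry, v.seen, v.deg, v.idx)) <| by
    rintro ⟨⟩ ⟨⟩ h
    simpa using h

namespace Expand

open TM2 TM2.Stmt

variable {A : Type} (sym : Bool → A) (read : A → Option Bool) {D m : ℕ}
  (T : Bool → Bool → Fin (D + 1) → Fin (m + 1) → Fin (m + 1) → Bool)

/-- The initial state of the expansion machine. -/
def initialState (A : Type) (D m : ℕ) : ExpandState A D m := ⟨none, none, none, true, false, 0, 0⟩

/-- The end of the treatment of an entry of the current row. -/
def endEntry : Stmt (ExpandAlphabet A) ExpandLabel (ExpandState A D m) :=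
  push .rev (fun v => ((v.entry.getD (false, false, false)).1, v.bit.getD false, v.carry)) <|
    load (fun v => { v with
      carry := (v.entry.getD (false, false, false)).2.2
      seen := v.seen || v.carry && !(v.entry.getD (false, false, false)).1
      deg := v.deg + if v.bit = some true then 1 else 0 }) <| goto fun _ => .row

/-- The program of the expansion machine. Given a graph with `n` vertices, it adds `n ^ 2 + 1`
isolated vertices, and then replaces every entry of the adjacency matrix by a square matrix of order
`m + 1`. The new matrix is given by `T` and depends on the entry,
on whether the entry is on the diagonal, and on the degree of the vertex. -/
def program : ExpandLabel → Stmt (ExpandAlphabet A) ExpandLabel (ExpandState A D m)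
  | .readSize =>
    pop .io (fun v o => { v with symbol := o }) <|
      branch (fun v => v.symbol.bind read = some true)
        (push .cur (fun _ => (true, false, false)) <| goto fun _ => .readSize)
        -- The separator and, below, each bit of the matrix contribute one additional vertex, which
        -- gives `n ^ 2 + 1` of them.
        (push .cur (fun _ => (false, false, false)) <| goto fun _ => .readMatrix)
  | .readMatrix =>
    pop .io (fun v o => { v with symbol := o }) <|
      branch (fun v => (v.symbol.bind read).isSome)
        (push .mat (fun v => (v.symbol.bind read).getD false) <|
          push .cur (fun _ => (false, false, false)) <| goto fun _ => .readMatrix)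
        -- A symbol that does not encode a bit ends the graph and is put back, since it belongs to
        -- the part of the input that must survive.
        (branch (fun v => v.symbol.isSome)
          (push .io (fun v => v.symbol.getD (sym false)) <| goto fun _ => .row)
          (goto fun _ => .row))
  | .row =>
    pop .cur (fun v o => { v with entry := o }) <|
      branch (fun v => v.entry.isSome)
        -- Only entries between two input vertices are stored in `mat`. The additional vertices come
        -- first in `cur`, so in the row of an additional vertex the diagonal is passed, and `seen`
        -- is set, before the first input vertex is met.
        (branch (fun v => (v.entry.getD (false, false, false)).1 && !v.seen)
          (pop .mat (fun v o => { v with bit := o }) endEntry)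
          (load (fun v => { v with bit := none }) endEntry))
        (load (fun v => { v with idx := 0 }) <| goto fun _ => .back)
  | .back =>
    move .rev .cur id id (false, false, false) ExpandState.entry (fun v o => { v with entry := o }) .back
      (goto fun _ => .emit)
  | .emit =>
    pop .cur (fun v o => { v with entry := o }) <|
      branch (fun v => v.entry.isSome)
        (push .rev (fun v => v.entry.getD (false, false, false)) <|
          pushList .io ((List.finRange (m + 1)).map fun a v =>
            sym (T (v.entry.getD (false, false, false)).2.1 (v.entry.getD (false, false, false)).2.2
              v.deg v.idx a))
          (goto fun _ => .emit))
        (branch (fun v => v.idx = Fin.last m) (goto fun _ => .restore)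
          (load (fun v => { v with idx := v.idx + 1 }) <| goto fun _ => .back))
  | .restore =>
    move .rev .cur id id (false, false, false) ExpandState.entry (fun v o => { v with entry := o })
      .restore
      (peek .mat (fun v o => { v with bit := o }) <|
        -- The rows of input vertices come last, so an empty `mat` means that all rows are done.
        branch (fun v => v.bit.isSome)
          (load (fun v => { v with carry := false, seen := false, deg := 0 }) <| goto fun _ => .row)
          (push .io (fun _ => sym false) <| goto fun _ => .finish))
  | .finish =>
    pop .cur (fun v o => { v with entry := o }) <|
      branch (fun v => v.entry.isSome)
        (pushList .io (List.replicate (m + 1) fun _ => sym true) <| goto fun _ => .finish)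
        (load (fun _ => initialState A D m) halt)

/-- The configuration of the stacks of the expansion machine. -/
def stackCfg (io : List A) (mat : List Bool) (cur rev : List (Bool × Bool × Bool)) :
    ∀ k, List (ExpandAlphabet A k)
  | .io => io
  | .mat => mat
  | .cur => cur
  | .rev => rev

section

variable (io io' : List A) (mat mat' : List Bool) (cur cur' rev rev' : List (Bool × Bool × Bool))

@[simp] theorem stackCfg_io : stackCfg io mat cur rev .io = io := rfl
@[simp] theorem stackCfg_mat : stackCfg io mat cur rev .mat = mat := rfl
@[simp] theorem stackCfg_cur : stackCfg io mat cur rev .cur = cur := rfl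
@[simp] theorem stackCfg_rev : stackCfg io mat cur rev .rev = rev := rfl

@[simp] theorem update_stackCfg_io :
    Function.update (stackCfg io mat cur rev) .io io' = stackCfg io' mat cur rev := by
  funext k; cases k <;> rfl

@[simp] theorem update_stackCfg_mat :
    Function.update (stackCfg io mat cur rev) .mat mat' = stackCfg io mat' cur rev := by
  funext k; cases k <;> rfl

@[simp] theorem update_stackCfg_cur :
    Function.update (stackCfg io mat cur rev) .cur cur' = stackCfg io mat cur' rev := by
  funext k; cases k <;> rfl

@[simp] theorem update_stackCfg_rev :
    Function.update (stackCfg io mat cur rev) .rev rev' = stackCfg io mat cur rev' := by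
  funext k; cases k <;> rfl

end

variable {sym read} {T}

theorem readSize_stepsIn (hsym : ∀ b, read (sym b) = some b) (n : ℕ) (v : ExpandState A D m)
    (t : List A) (mat : List Bool) (cur rev : List (Bool × Bool × Bool)) :
    StepsIn (program sym read T) (n + 1)
      ⟨some .readSize, v, stackCfg (List.replicate n (sym true) ++ sym false :: t) mat cur rev⟩
      ⟨some .readMatrix, { v with symbol := some (sym false) },
        stackCfg t mat ((false, false, false) :: (List.replicate n (true, false, false) ++ cur)) rev⟩ := by
  induction n generalizing v cur with
  | zero =>
    refine StepsIn.head ?_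
    simp [program, hsym, StepsIn.refl]
  | succ n ih =>
    refine StepsIn.head ?_
    have := ih { v with symbol := some (sym true) } ((true, false, false) :: cur)
    simp only [program, List.replicate_succ]
    simp [hsym]
    have e : List.replicate n (true, false, false) ++ (true, false, false) :: cur =
        (true, false, false) :: (List.replicate n (true, false, false) ++ cur) := by
      rw [← List.cons_append, ← List.replicate_succ, List.replicate_succ', List.append_assoc]
      rfl
    rwa [e] at this

theorem readMatrix_stepsIn (hsym : ∀ b, read (sym b) = some b) (l : List Bool)
    (v : ExpandState A D m) (t : List A) (ht : t.head?.bind read = none) (mat : List Bool)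
    (cur rev : List (Bool × Bool × Bool)) :
    StepsIn (program sym read T) (l.length + 1)
      ⟨some .readMatrix, v, stackCfg (l.map sym ++ t) mat cur rev⟩
      ⟨some .row, { v with symbol := t.head? }, stackCfg t (l.reverse ++ mat)
        (List.replicate l.length (false, false, false) ++ cur) rev⟩ := by
  induction l generalizing v mat cur with
  | nil =>
    refine StepsIn.head ?_
    cases t with
    | nil => simp [program, StepsIn.refl]
    | cons a t =>
      have : read a = none := by simpa using ht
      simp [program, StepsIn.refl, this]
  | cons b l ih =>
    refine StepsIn.head ?_
    have := ih { v with symbol := some (sym b) } (b :: mat) ((false, false, false) :: cur)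
    have e : List.replicate l.length (false, false, false) ++ (false, false, false) :: cur =
        (false, false, false) :: (List.replicate l.length (false, false, false) ++ cur) := by
      rw [← List.cons_append, ← List.replicate_succ, List.replicate_succ', List.append_assoc]
      rfl
    rw [e] at this
    simp only [program, List.map_cons, List.cons_append]
    simpa [hsym, List.replicate_succ] using this

/-- The new current row and the remaining matrix after the loop that reads a row. -/
def rowPass (seen carry : Bool) : List (Bool × Bool × Bool) → List Bool →
    List (Bool × Bool × Bool) × List Bool
  | [], mat => ([], mat)
  | e :: cur, mat =>
    let r := rowPass (seen || carry && !e.1) e.2.2 cur (if e.1 && !seen then mat.tail else mat)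
    ((e.1, (if e.1 && !seen then mat.head? else none).getD false, carry) :: r.1, r.2)

theorem row_stepsIn (cur : List (Bool × Bool × Bool)) (v : ExpandState A D m) (io : List A)
    (mat : List Bool) (rev : List (Bool × Bool × Bool)) :
    ∃ v' : ExpandState A D m, v'.deg = Fin.ofNat (D + 1)
        (v.deg + ((rowPass v.seen v.carry cur mat).1.map fun e => e.2.1).count true) ∧ v'.idx = 0 ∧
      StepsIn (program sym read T) (cur.length + 1)
        ⟨some .row, v, stackCfg io mat cur rev⟩
        ⟨some .back, v', stackCfg io (rowPass v.seen v.carry cur mat).2 []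
          ((rowPass v.seen v.carry cur mat).1.reverse ++ rev)⟩ := by
  induction cur generalizing v mat rev with
  | nil =>
    refine ⟨{ v with entry := none, idx := 0 }, by simp [rowPass], rfl, StepsIn.head ?_⟩
    simp [program, rowPass, StepsIn.refl]
  | cons e cur ih =>
    obtain ⟨v', h1, h2, h3⟩ := ih
      { v with
        entry := some e
        bit := if e.1 && !v.seen then mat.head? else none
        carry := e.2.2
        seen := v.seen || v.carry && !e.1
        deg := v.deg + if (if e.1 && !v.seen then mat.head? else none) = some true then 1 else 0 }
      (if e.1 && !v.seen then mat.tail else mat)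
      ((e.1, (if e.1 && !v.seen then mat.head? else none).getD false, v.carry) :: rev)
    refine ⟨v', ?_, h2, StepsIn.head ?_⟩
    · rw [h1, rowPass]
      simp only [List.map_cons]
      generalize (if e.1 && !v.seen then mat.head? else none) = b
      ext
      rcases b with _ | _ | _ <;> simp [Fin.ofNat, Fin.val_add, add_assoc, add_comm 1]
    · simp only [program]
      rcases hb : (e.1 && !v.seen) with _ | _
      · simp only [hb] at h3
        simpa [endEntry, rowPass, hb] using h3
      · simp only [hb] at h3
        simpa [endEntry, rowPass, hb] using h3

theorem back_stepsIn (v : ExpandState A D m) (io : List A) (mat : List Bool)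
    (cur rev : List (Bool × Bool × Bool)) :
    StepsIn (program sym read T) (rev.length + 1)
      ⟨some .back, v, stackCfg io mat cur rev⟩
      ⟨some .emit, { v with entry := none }, stackCfg io mat (rev.reverse ++ cur) []⟩ := by
  refine stepsIn_move (n := 0) (X := Bool × Bool × Bool) (p := ExpandStack.rev) (q := ExpandStack.cur)
    (get := ExpandState.entry)
    (put := fun v o => { v with entry := o }) (by decide) (fun _ _ => rfl) (fun _ _ _ => rfl) rfl
    _ _ _ rfl ?_
  simp [StepsIn.refl]

/-- The part of the output that belongs to the row `l` in its copy number `i`. -/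
def rowOutput (T : Bool → Bool → Fin (D + 1) → Fin (m + 1) → Fin (m + 1) → Bool)
    (deg : Fin (D + 1)) (l : List (Bool × Bool × Bool)) (i : Fin (m + 1)) : List Bool :=
  l.flatMap fun e => (List.finRange (m + 1)).map fun a => T e.2.1 e.2.2 deg i a

theorem emit_stepsIn (v : ExpandState A D m) (io : List A) (mat : List Bool)
    (cur rev : List (Bool × Bool × Bool)) {n : ℕ} {c}
    (h : StepsIn (program sym read T) n
      (if v.idx = Fin.last m then
        ⟨some .restore, { v with entry := none }, stackCfg
          (((rowOutput T v.deg cur v.idx).map sym).reverse ++ io) mat [] (cur.reverse ++ rev)⟩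
      else ⟨some .back, { v with entry := none, idx := v.idx + 1 }, stackCfg
          (((rowOutput T v.deg cur v.idx).map sym).reverse ++ io) mat [] (cur.reverse ++ rev)⟩) c) :
    StepsIn (program sym read T) (cur.length + 1 + n)
      ⟨some .emit, v, stackCfg io mat cur rev⟩ c := by
  rw [Nat.add_right_comm]
  induction cur generalizing v io rev with
  | nil =>
    refine StepsIn.head ?_
    split_ifs at h with hv
    · simpa [program, hv, rowOutput] using h
    · simpa [program, hv, rowOutput] using h
  | cons e cur ih =>
    refine StepsIn.head ?_
    simp only [program]
    simp only [stepAux, stackCfg_cur, List.head?_cons, Option.isSome_some, cond_true,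
      update_stackCfg_cur, List.tail_cons, stackCfg_rev, update_stackCfg_rev, Option.getD_some,
      stepAux_pushList, stackCfg_io, update_stackCfg_io, List.length_cons]
    rw [Nat.add_right_comm]
    refine ih _ _ _ ?_
    simpa [rowOutput, Function.comp_def] using h

theorem finish_stepsIn (v : ExpandState A D m) (io : List A) (cur : List (Bool × Bool × Bool)) :
    StepsIn (program sym read T) (cur.length + 1)
      ⟨some .finish, v, stackCfg io [] cur []⟩
      ⟨none, initialState A D m,
        stackCfg (List.replicate (cur.length * (m + 1)) (sym true) ++ io) [] [] []⟩ := by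
  induction cur generalizing v io with
  | nil =>
    refine StepsIn.head ?_
    simp [program, StepsIn.refl]
  | cons e cur ih =>
    refine StepsIn.head ?_
    simp only [program]
    simp only [stepAux, stackCfg_cur, List.head?_cons, Option.isSome_some, cond_true,
      update_stackCfg_cur, List.tail_cons, stepAux_pushList, stackCfg_io, update_stackCfg_io,
      List.length_cons]
    have := ih { v with entry := some e } (List.replicate (m + 1) (sym true) ++ io)
    rw [← List.append_assoc, List.replicate_append_replicate, ← Nat.succ_mul] at this
    simpa using this

end Expand

end Turing

/-! ### Correctness of the expansion machine -/

namespace Turing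

namespace Expand

open TM2 TM2.Stmt

variable {A : Type} {sym : Bool → A} {read : A → Option Bool} {D m : ℕ}
  {T : Bool → Bool → Fin (D + 1) → Fin (m + 1) → Fin (m + 1) → Bool}

theorem copies_stepsIn (c : List (Bool × Bool × Bool)) (mat : List Bool) (j : ℕ) (v : ExpandState A D m)
    (hj : v.idx + j = m) (io : List A) :
    ∃ v', StepsIn (program sym read T) ((j + 1) * (2 * (c.length + 1)))
      ⟨some .back, v, stackCfg io mat [] c.reverse⟩
      ⟨some .restore, v', stackCfg (((((List.finRange (m + 1)).drop v.idx).flatMap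
        (rowOutput T v.deg c)).map sym).reverse ++ io) mat [] c.reverse⟩ := by
  have key : ∀ (v : ExpandState A D m) (io : List A) (n : ℕ) (d), 
      StepsIn (program sym read T) n
        (if v.idx = Fin.last m then
          ⟨some .restore, { v with entry := none }, stackCfg
            (((rowOutput T v.deg c v.idx).map sym).reverse ++ io) mat [] c.reverse⟩
        else ⟨some .back, { v with entry := none, idx := v.idx + 1 }, stackCfg
            (((rowOutput T v.deg c v.idx).map sym).reverse ++ io) mat [] c.reverse⟩) d →
      StepsIn (program sym read T) (2 * (c.length + 1) + n)
        ⟨some .back, v, stackCfg io mat [] c.reverse⟩ d := by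
    intro v io n d h
    have h1 := back_stepsIn (sym := sym) (read := read) (T := T) v io mat [] c.reverse
    simp only [List.reverse_reverse, List.append_nil, List.length_reverse] at h1
    rw [two_mul, add_assoc]
    refine h1.trans (emit_stepsIn _ _ _ _ _ ?_)
    simpa using h
  induction j generalizing v io with
  | zero =>
    have hv : v.idx = Fin.last m := by ext; simpa using hj
    refine ⟨{ v with entry := none }, ?_⟩
    have h1 := key v io 0 _ (by rw [if_pos hv]; exact StepsIn.refl _)
    convert h1 using 2
    · ring
    · have : (List.finRange (m + 1)).drop v.idx = [v.idx] := by
        rw [List.drop_eq_getElem_cons (by simp; omega), List.drop_eq_nil_of_le (by simp [hv])]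
        simp
      rw [this]
      simp
  | succ j ih =>
    have hv : v.idx ≠ Fin.last m := by
      intro h
      rw [h, Fin.val_last] at hj
      omega
    have hv1 : ((v.idx + 1 : Fin (m + 1)) : ℕ) = v.idx + 1 := Fin.val_add_one_of_lt' (by omega)
    obtain ⟨v', h⟩ := ih { v with entry := none, idx := v.idx + 1 } (by simp only [hv1]; omega)
      (((rowOutput T v.deg c v.idx).map sym).reverse ++ io)
    refine ⟨v', ?_⟩
    have h1 := key v io _ _ (by rw [if_neg hv]; exact h)
    convert h1 using 2
    · ring
    · rw [List.drop_eq_getElem_cons (by simp; omega)]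
      simp [hv1]

theorem restore_stepsIn (c : List (Bool × Bool × Bool)) (mat : List Bool) (v : ExpandState A D m)
    (io : List A) :
    StepsIn (program sym read T) (c.length + 1)
      ⟨some .restore, v, stackCfg io mat [] c.reverse⟩
      (if mat = [] then
        ⟨some .finish, { v with entry := none, bit := none }, stackCfg (sym false :: io) mat c []⟩
      else ⟨some .row, { v with entry := none, bit := mat.head?, carry := false, seen := false, deg := 0 },
        stackCfg io mat c []⟩) := by
  rw [← List.length_reverse]
  refine stepsIn_move (n := 0) (X := Bool × Bool × Bool) (p := ExpandStack.rev) (q := ExpandStack.cur)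
    (get := ExpandState.entry)
    (put := fun v o => { v with entry := o }) (by decide) (fun _ _ => rfl) (fun _ _ _ => rfl) rfl
    _ _ _ rfl ?_
  cases mat <;> simp [StepsIn.refl]

/-- The row `i` of a matrix, with marks for the vertices of the input and for the diagonal entry. -/
def markedRow (δ : ℕ) {n : ℕ} (B : Fin n → Fin n → Bool) (i : Fin n) :
    List (Bool × Bool × Bool) :=
  (List.finRange n).map fun p : Fin n => (decide (δ ≤ (p : ℕ)), B i p, decide (p = i))

/-- The number of ones in the row `i` of a matrix. -/
def rowSum (D : ℕ) {n : ℕ} (B : Fin n → Fin n → Bool) (i : Fin n) : Fin (D + 1) :=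
  Fin.ofNat (D + 1) (((List.finRange n).map (B i)).count true)

/-- The entries of the row `i` of a matrix, without the rows and columns of number less
than `δ`. -/
def condensedRow (δ : ℕ) {n : ℕ} (B : Fin n → Fin n → Bool) (i : Fin n) (l : List (Fin n)) :
    List Bool :=
  l.flatMap fun p : Fin n => if δ ≤ i ∧ δ ≤ p then [B i p] else []

theorem condensedRow_cons (δ : ℕ) {n : ℕ} (B : Fin n → Fin n → Bool) (i p : Fin n)
    (l : List (Fin n)) :
    condensedRow δ B i (p :: l) =
      (if δ ≤ (i : ℕ) ∧ δ ≤ (p : ℕ) then [B i p] else []) ++ condensedRow δ B i l :=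
  List.flatMap_cons

/-- The invariant before column `j`: `seen` says that the row belongs to an additional vertex whose
diagonal lies behind, and `carry` says that `j` is the diagonal. The previous row carries its mark
at `i - 1`, and each pass shifts the mark by one. -/
theorem rowPass_drop {δ n : ℕ} {B : Fin n → Fin n → Bool} {i : Fin n}
    (hB : ∀ p : Fin n, B i p = true → δ ≤ (i : ℕ) ∧ δ ≤ (p : ℕ)) (rest : List Bool) (k j : ℕ) (hk : n ≤ j + k)
    (prev : List (Bool × Bool × Bool))
    (hprev : prev.map (fun e => (e.1, e.2.2)) =
      ((List.finRange n).drop j).map fun p : Fin n => (decide (δ ≤ (p : ℕ)), decide ((p : ℕ) + 1 = i))) :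
    rowPass (decide ((i : ℕ) < j ∧ i < δ)) (decide (j = i)) prev
      (condensedRow δ B i ((List.finRange n).drop j) ++ rest) =
      ((markedRow δ B i).drop j, rest) := by
  induction k generalizing j prev with
  | zero =>
    have h0 : (List.finRange n).drop j = [] := List.drop_eq_nil_of_le (by simpa using hk)
    rw [h0, List.map_nil, List.map_eq_nil_iff] at hprev
    rw [markedRow, ← List.map_drop, h0, hprev]
    simp [rowPass, condensedRow]
  | succ k ih =>
    by_cases hj : n ≤ j
    · exact ih j (by omega) prev hprev
    push Not at hj
    have h0 : (List.finRange n).drop j = ⟨j, hj⟩ :: (List.finRange n).drop (j + 1) := by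
      rw [List.drop_eq_getElem_cons (by simpa using hj)]
      simp
    rw [h0, List.map_cons] at hprev
    cases prev with
    | nil => simp at hprev
    | cons e prev =>
      obtain ⟨e₁, e₂, e₃⟩ := e
      simp only [List.map_cons, List.cons.injEq, Prod.mk.injEq] at hprev
      obtain ⟨⟨rfl, rfl⟩, hprev⟩ := hprev
      have h1 : (decide ((i : ℕ) < j ∧ i < δ) || decide (j = i) && !decide (δ ≤ j)) =
          decide ((i : ℕ) < j + 1 ∧ i < δ) := by
        rw [Bool.eq_iff_iff]
        simp
        omega
      -- If `i < δ ≤ j`, then the diagonal has been passed; hence a bit is consumed exactly for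
      -- entries between input vertices.
      have h2 : (decide (δ ≤ j) && !decide ((i : ℕ) < j ∧ i < δ)) = decide (δ ≤ i ∧ δ ≤ j) := by
        rw [Bool.eq_iff_iff]
        simp
        omega
      have h3 := ih (j + 1) (by omega) prev hprev
      rw [rowPass, h1, h2, markedRow, ← List.map_drop, h0, List.map_cons]
      have h4 : decide (j = i) = decide ((⟨j, hj⟩ : Fin n) = i) := by
        simp [Fin.ext_iff]
      rw [h4]
      by_cases hd : δ ≤ i ∧ δ ≤ j
      · rw [condensedRow_cons, if_pos hd, decide_eq_true hd, List.cons_append, List.nil_append,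
          if_pos rfl, if_pos rfl, List.cons_append, List.tail_cons, h3, markedRow, List.map_drop]
        rfl
      · have hb : B i ⟨j, hj⟩ = false := by
          rw [Bool.eq_false_iff]
          exact fun h => hd (hB _ h)
        rw [condensedRow_cons, if_neg hd, decide_eq_false hd, List.nil_append, if_neg (by simp),
          if_neg (by simp), h3, hb, markedRow, List.map_drop]
        rfl

theorem wholeRow_stepsIn {δ n : ℕ} {B : Fin n → Fin n → Bool} {i : Fin n}
    (hB : ∀ p : Fin n, B i p = true → δ ≤ (i : ℕ) ∧ δ ≤ (p : ℕ)) (prev : List (Bool × Bool × Bool))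
    (hprev : prev.map (fun e => (e.1, e.2.2)) =
      (List.finRange n).map fun p : Fin n => (decide (δ ≤ (p : ℕ)), decide ((p : ℕ) + 1 = i)))
    (v : ExpandState A D m) (hs : v.seen = false) (hc : v.carry = decide ((i : ℕ) = 0))
    (hd : v.deg = 0) (io : List A) (mat : List Bool) :
    ∃ v' : ExpandState A D m, StepsIn (program sym read T)
      ((n + 1) + (m + 1) * (2 * (n + 1)))
      ⟨some .row, v, stackCfg io (condensedRow δ B i (List.finRange n) ++ mat) prev []⟩
      ⟨some .restore, v', stackCfg ((((List.finRange (m + 1)).flatMap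
        (rowOutput T (rowSum D B i) (markedRow δ B i))).map sym).reverse ++ io)
        mat [] (markedRow δ B i).reverse⟩ := by
  have hr := rowPass_drop hB mat n 0 (by omega) prev (by simpa using hprev)
  have e0 : decide ((i : ℕ) < 0 ∧ i < δ) = v.seen := by simp [hs]
  have e1 : decide (0 = (i : ℕ)) = v.carry := by simp [hc, eq_comm]
  rw [e0, e1, List.drop_zero, List.drop_zero] at hr
  have hpl : prev.length = n := by simpa using congrArg List.length hprev
  obtain ⟨v₁, h1, h2, h3⟩ := row_stepsIn (sym := sym) (read := read) (T := T) prev v io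
    (condensedRow δ B i (List.finRange n) ++ mat) []
  have hcl : (markedRow δ B i).length = n := by simp [markedRow]
  obtain ⟨v₂, h4⟩ := copies_stepsIn (sym := sym) (read := read) (T := T) (markedRow δ B i) mat m v₁
    (by simp [h2]) io
  refine ⟨v₂, ?_⟩
  rw [hr, hpl, List.append_nil] at h3
  rw [hcl] at h4
  have h5 : v₁.deg = rowSum D B i := by
    rw [h1, hr, hd, rowSum]
    simp [markedRow, Function.comp_def]
  have := h3.trans h4
  simpa [h2, h5] using this

theorem allRows_stepsIn {δ n : ℕ} (hδ : δ < n) {B : Fin n → Fin n → Bool}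
    (hB : ∀ i p : Fin n, B i p = true → δ ≤ (i : ℕ) ∧ δ ≤ (p : ℕ)) (j i : ℕ) (hij : i + j + 1 = n)
    (prev : List (Bool × Bool × Bool))
    (hprev : prev.map (fun e => (e.1, e.2.2)) =
      (List.finRange n).map fun p : Fin n => (decide (δ ≤ (p : ℕ)), decide ((p : ℕ) + 1 = i)))
    (v : ExpandState A D m) (hs : v.seen = false) (hc : v.carry = decide (i = 0))
    (hd : v.deg = 0) (io : List A) :
    ∃ (v' : ExpandState A D m) (c : List (Bool × Bool × Bool)), c.length = n ∧
      StepsIn (program sym read T)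
        ((j + 1) * ((n + 1) + (m + 1) * (2 * (n + 1)) + (n + 1)))
      ⟨some .row, v, stackCfg io (((List.finRange n).drop i).flatMap
        fun i => condensedRow δ B i (List.finRange n)) prev []⟩
      ⟨some .finish, v', stackCfg (sym false :: ((((List.finRange n).drop i).flatMap fun i =>
        (List.finRange (m + 1)).flatMap (rowOutput T (rowSum D B i) (markedRow δ B i))).map
          sym).reverse ++ io) [] c []⟩ := by
  have hi : i < n := by omega
  have hdrop : (List.finRange n).drop i = ⟨i, hi⟩ :: (List.finRange n).drop (i + 1) := by
    rw [List.drop_eq_getElem_cons (by simpa using hi)]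
    simp
  have hl : (markedRow δ B ⟨i, hi⟩).length = n := by simp [markedRow]
  induction j generalizing i prev v io with
  | zero =>
    rw [List.drop_eq_nil_of_le (show (List.finRange n).length ≤ i + 1 by simp; omega)] at hdrop
    obtain ⟨v', h⟩ := wholeRow_stepsIn (sym := sym) (read := read) (T := T) (hB ⟨i, hi⟩) prev hprev
      v hs hc hd io []
    have h' := restore_stepsIn (sym := sym) (read := read) (T := T) (markedRow δ B ⟨i, hi⟩) [] v'
      (((((List.finRange (m + 1)).flatMap (rowOutput T (rowSum D B ⟨i, hi⟩)
        (markedRow δ B ⟨i, hi⟩)))).map sym).reverse ++ io)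
    rw [if_pos rfl, hl] at h'
    refine ⟨{ v' with entry := none, bit := none }, markedRow δ B ⟨i, hi⟩, hl, ?_⟩
    rw [hdrop, zero_add, one_mul]
    simpa using h.trans h'
  | succ j ih =>
    set mat := ((List.finRange n).drop (i + 1)).flatMap fun i => condensedRow δ B i (List.finRange n)
      with hmat
    -- The last vertex is an input vertex, and its row has at least its diagonal entry in `mat`; so
    -- the machine cannot stop before the last row.
    have hne : mat ≠ [] := by
      rw [← List.length_pos_iff, hmat, List.length_flatMap, List.sum_pos_iff_exists_pos_nat]
      have hlast : (⟨n - 1, by omega⟩ : Fin n) ∈ (List.finRange n).drop (i + 1) :=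
        List.mem_drop_iff_getElem.2 ⟨n - 1 - (i + 1), by simp; omega, by simp [Fin.ext_iff]; omega⟩
      refine ⟨_, List.mem_map_of_mem hlast, ?_⟩
      rw [condensedRow, List.length_flatMap, List.sum_pos_iff_exists_pos_nat]
      refine ⟨_, List.mem_map_of_mem (List.mem_finRange ⟨n - 1, by omega⟩), ?_⟩
      simp [show δ ≤ n - 1 by omega]
    obtain ⟨v', h⟩ := wholeRow_stepsIn (sym := sym) (read := read) (T := T) (hB ⟨i, hi⟩) prev hprev
      v hs hc hd io mat
    have h' := restore_stepsIn (sym := sym) (read := read) (T := T) (markedRow δ B ⟨i, hi⟩) mat v'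
      (((((List.finRange (m + 1)).flatMap (rowOutput T (rowSum D B ⟨i, hi⟩)
        (markedRow δ B ⟨i, hi⟩)))).map sym).reverse ++ io)
    rw [if_neg hne, hl] at h'
    have hi' : i + 1 < n := by omega
    obtain ⟨v'', c, hcl, h''⟩ := ih (i + 1) (by omega) (markedRow δ B ⟨i, hi⟩)
      (by simp [markedRow, Fin.ext_iff])
      { v' with entry := none, bit := mat.head?, carry := false, seen := false, deg := 0 } rfl
      (by simp) rfl
      (((((List.finRange (m + 1)).flatMap (rowOutput T (rowSum D B ⟨i, hi⟩)
        (markedRow δ B ⟨i, hi⟩)))).map sym).reverse ++ io) hi'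
      (by rw [List.drop_eq_getElem_cons (by simpa using hi')]; simp) (by simp [markedRow])
    refine ⟨v'', c, hcl, ?_⟩
    have H := (h.trans h').trans h''
    rw [hdrop]
    convert H using 2
    · ring
    · simp [hmat]
    · simp

/-- The output matrix of the expansion machine. -/
def expansion (T : Bool → Bool → Fin (D + 1) → Fin (m + 1) → Fin (m + 1) → Bool) {n : ℕ}
    (B : Fin n → Fin n → Bool) : List Bool :=
  (List.finRange n).flatMap fun i =>
    (List.finRange (m + 1)).flatMap (rowOutput T (rowSum D B i) (markedRow 0 B i))

theorem rowOutput_markedRow (δ : ℕ) {n : ℕ} (B : Fin n → Fin n → Bool) (i : Fin n) :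
    rowOutput T (rowSum D B i) (markedRow δ B i) =
      rowOutput T (rowSum D B i) (markedRow 0 B i) := by
  funext a
  simp [rowOutput, markedRow, List.flatMap_map]

/-- Stacks reverse twice: the matrix is read from its last bit, and the output is written from its
last symbol. Hence `B` is indexed by the vertices in reverse order, the expansion appears reversed,
and the unary order of the new graph is written at the very end. -/
theorem program_stepsIn (hsym : ∀ b, read (sym b) = some b) {n δ : ℕ} (hn : 0 < n)
    {B : Fin (δ + n) → Fin (δ + n) → Bool} (hB : ∀ i p, B i p = true → δ ≤ i ∧ δ ≤ p)
    (l : List Bool) (hδ : δ = l.length + 1)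
    (hl : l.reverse =
      (List.finRange (δ + n)).flatMap fun i => condensedRow δ B i (List.finRange (δ + n)))
    (t : List A) (ht : t.head?.bind read = none) :
    StepsIn (program sym read T)
      (n + 1 + (l.length + 1) + (δ + n) * ((δ + n + 1) + (m + 1) * (2 * (δ + n + 1)) +
        (δ + n + 1)) + (δ + n + 1))
      ⟨some .readSize, initialState A D m,
        stackCfg ((List.replicate n true ++ false :: l).map sym ++ t) [] [] []⟩
      ⟨none, initialState A D m, stackCfg ((List.replicate ((δ + n) * (m + 1)) true ++
        false :: (expansion T B).reverse).map sym ++ t) [] [] []⟩ := by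
  have h1 := readSize_stepsIn (sym := sym) (read := read) (T := T) hsym n (initialState A D m)
    (l.map sym ++ t) [] [] []
  have h2 := readMatrix_stepsIn (sym := sym) (read := read) (T := T) hsym l
    { initialState A D m with symbol := some (sym false) } t ht []
    ((false, false, false) :: (List.replicate n (true, false, false) ++ [])) []
  have e : List.replicate l.length (false, false, false) ++
      (false, false, false) :: (List.replicate n (true, false, false) ++ []) =
      List.replicate δ (false, false, false) ++ List.replicate n (true, false, false) := by
    rw [hδ, List.replicate_succ', List.append_assoc]
    simp
  rw [e] at h2
  obtain ⟨v, c, hc, h3⟩ := allRows_stepsIn (sym := sym) (read := read) (T := T)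
    (show δ < δ + n by omega) hB (δ + n - 1) 0 (by omega)
    (List.replicate δ (false, false, false) ++ List.replicate n (true, false, false))
    (by
      refine List.ext_getElem (by simp) fun p h1 h2 => ?_
      simp [List.getElem_append]
      split_ifs <;> simp <;> omega)
    { initialState A D m with symbol := t.head? } rfl rfl rfl t
  have h4 := finish_stepsIn (sym := sym) (read := read) (T := T) v
    (sym false :: ((((List.finRange (δ + n)).drop 0).flatMap fun i =>
      (List.finRange (m + 1)).flatMap (rowOutput T (rowSum D B i) (markedRow δ B i))).map
          sym).reverse ++ t) c
  rw [hc] at h4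
  rw [Nat.sub_add_cancel (by omega), List.drop_zero, ← hl] at h3
  rw [List.append_nil l.reverse] at h2
  have H := ((h1.trans h2).trans h3).trans h4
  convert H using 2
  · simp
  · simp [expansion, List.map_reverse, rowOutput_markedRow δ]

end Expand

end Turing

/-! ### Polynomial running time of the expansion -/

namespace Turing

/-- The expansion machine. -/
noncomputable def expandMachine {A : Type} [Fintype A] (sym : Bool → A) (read : A → Option Bool)
    {D m : ℕ} (T : Bool → Bool → Fin (D + 1) → Fin (m + 1) → Fin (m + 1) → Bool) : FinTM2 where
  K := ExpandStack
  k₀ := .io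
  k₁ := .io
  Γ := ExpandAlphabet A
  Λ := ExpandLabel
  main := .readSize
  σ := ExpandState A D m
  initialState := Expand.initialState A D m
  Γk₀Fin := inferInstanceAs (Fintype A)
  m := Expand.program sym read T

theorem nonempty_expand_computable {A α β : Type} [Fintype A] {sym : Bool → A}
    {read : A → Option Bool} (hsym : ∀ b, read (sym b) = some b) {D m : ℕ}
    (T : Bool → Bool → Fin (D + 1) → Fin (m + 1) → Fin (m + 1) → Bool)
    {ea : α → List A} {eb : β → List A} {f : α → β}
    (h : ∀ x, ∃ (n δ : ℕ) (B : Fin (δ + n) → Fin (δ + n) → Bool) (l : List Bool) (t : List A),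
      0 < n ∧ (∀ i p, B i p = true → δ ≤ (i : ℕ) ∧ δ ≤ (p : ℕ)) ∧ δ = l.length + 1 ∧
      l.reverse = ((List.finRange (δ + n)).flatMap fun i =>
        Expand.condensedRow δ B i (List.finRange (δ + n))) ∧
      t.head?.bind read = none ∧ ea x = (List.replicate n true ++ false :: l).map sym ++ t ∧
      eb (f x) = (List.replicate ((δ + n) * (m + 1)) true ++
        false :: (Expand.expansion T B).reverse).map sym ++ t) :
    Nonempty (TM2ComputableInPolyTime ea eb f) := by
  let X : Polynomial ℕ := Polynomial.X
  -- This is the step count of `program_stepsIn` with `X` in place of `δ + n`, the length of the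
  -- code of the graph; here `l.length + 1 = δ`.
  let p : Polynomial ℕ :=
    X + X * ((X + 1) + Polynomial.C (m + 1) * (2 * (X + 1)) + (X + 1)) + (X + 2)
  refine ⟨⟨⟨expandMachine sym read T, Equiv.refl A, Equiv.refl A⟩, p, fun x => ?_⟩⟩
  refine Classical.choice ?_
  obtain ⟨n, δ, B, l, t, hn, hB, hδ, hl, ht, hx, hfx⟩ := h x
  have H := Expand.program_stepsIn (T := T) hsym hn hB l hδ hl t ht
  have hs : ∀ s : List A, Expand.stackCfg s [] [] [] =
      Function.update (β := fun k => List (ExpandAlphabet A k)) (fun _ => []) .io s := by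
    intro s
    funext k
    cases k <;> rfl
  rw [← hx, ← hfx, hs, hs] at H
  have i₁ : ∀ s : List A, s.map (Equiv.refl A).symm = s := fun s => List.map_id s
  unfold TM2OutputsInTime
  rw [initList_eq, Option.map_some, haltList_eq]
  have hp : n + 1 + (l.length + 1) + (δ + n) * ((δ + n + 1) + (m + 1) * (2 * (δ + n + 1)) +
      (δ + n + 1)) + (δ + n + 1) ≤ p.eval (ea x).length := by
    have hle : δ + n ≤ (ea x).length := by
      rw [hx]
      simp
      omega
    refine le_trans (le_of_eq ?_) (monotone_eval_polynomial p hle)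
    simp [p, X, hδ]
    ring
  refine ⟨⟨⟨_, ?_⟩, hp⟩⟩
  change (flip bind (TM2.step (Expand.program sym read T)))^[_]
    (some ⟨some .readSize, Expand.initialState A D m,
      Function.update (β := fun k => List (ExpandAlphabet A k)) (fun _ => []) .io
        ((ea x).map (Equiv.refl A).symm)⟩) =
    some ⟨none, Expand.initialState A D m,
      Function.update (β := fun k => List (ExpandAlphabet A k)) (fun _ => []) .io
        ((eb (f x)).map (Equiv.refl A).symm)⟩
  rw [i₁, i₁]
  exact H

end Turing

/-! ### Adjacency matrices in reverse order, and padding -/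

theorem List.finRange_mul (n k : ℕ) :
    List.finRange (n * k) =
      (List.finRange n).flatMap fun v => (List.finRange k).map fun a => finProdFinEquiv (v, a) := by
  rw [← List.ofFn_id, List.ofFn_mul, List.flatMap, ← List.ofFn_eq_map]
  congr 2
  funext v
  rw [List.ofFn_eq_map]
  congr 1
  funext a
  ext
  simp [add_comm, mul_comm]

namespace FinGraph

open Classical in
/-- The entries of the adjacency matrix with the vertices in reverse order. -/
noncomputable def revMatrix (G : FinGraph) (i p : Fin G.n) : Bool := decide (G.graph.Adj i.rev p.rev)

open Classical in
theorem rowSum_revMatrix (D : ℕ) (G : FinGraph) (i : Fin G.n) :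
    Turing.Expand.rowSum D G.revMatrix i.rev = Fin.ofNat (D + 1) (G.graph.degree i) := by
  rw [Turing.Expand.rowSum]
  congr 1
  rw [List.count_eq_countP, List.countP_map, ← SimpleGraph.card_neighborFinset_eq_degree,
    SimpleGraph.neighborFinset_eq_filter, List.countP_eq_length_filter,
    ← List.toFinset_card_of_nodup ((List.nodup_finRange _).filter _)]
  refine Finset.card_bij (fun p _ => p.rev) ?_ ?_ ?_
  · intro p hp
    simpa [revMatrix] using hp
  · intro p _ q _ h
    exact Fin.rev_injective h
  · intro u hu
    exact ⟨u.rev, by simpa [revMatrix] using hu, by simp⟩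

open Classical in
/-- If the adjacency matrix of a graph is obtained by replacing the entries of that of `G` by
matrices, then the expansion machine computes it. -/
theorem adjBits_eq_expansion {D m : ℕ}
    (T : Bool → Bool → Fin (D + 1) → Fin (m + 1) → Fin (m + 1) → Bool) (G : FinGraph)
    (H : SimpleGraph (Fin (G.n * (m + 1)))) (hH : 0 < G.n * (m + 1))
    (h : ∀ u v a b, H.Adj (finProdFinEquiv (u, a)) (finProdFinEquiv (v, b)) ↔
      T (decide (G.graph.Adj u v)) (decide (v = u)) (Fin.ofNat (D + 1) (G.graph.degree u)) a b
        = true) :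
    adjBits ⟨G.n * (m + 1), hH, H⟩ =
      (Turing.Expand.expansion (fun x y d a b => T x y d a.rev b.rev) G.revMatrix).reverse := by
  rw [eq_comm, Turing.Expand.expansion, List.reverse_flatMap, List.finRange_reverse,
    List.flatMap_map]
  simp only [Function.comp_apply, List.reverse_flatMap, List.finRange_reverse, List.flatMap_map,
    Turing.Expand.rowOutput, Turing.Expand.markedRow, ← List.map_reverse, List.map_map,
    Function.comp_def, Fin.rev_rev, rowSum_revMatrix, revMatrix]
  rw [adjBits]
  simp only [List.finRange_mul, List.flatMap_assoc, List.flatMap_map, List.map_flatMap,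
    List.map_map, Function.comp_def, h, Fin.rev_inj]
  simp

theorem adjBits_length (G : FinGraph) : G.adjBits.length = G.n * G.n := by
  simp [adjBits]

/-- The graph with `n ^ 2 + 1` additional isolated vertices, where `n` is the number of vertices. -/
def pad (G : FinGraph) : FinGraph where
  n := G.n * G.n + 1 + G.n
  n_pos := by omega
  graph :=
    { Adj := fun u v => ∃ (hu : u < G.n) (hv : v < G.n), G.graph.Adj ⟨u, hu⟩ ⟨v, hv⟩
      symm := ⟨fun _ _ ⟨hu, hv, h⟩ => ⟨hv, hu, h.symm⟩⟩
      loopless := ⟨fun _ ⟨_, _, h⟩ => h.ne rfl⟩ }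

/-- The adjacency matrix of `G.pad`, with the vertices in reverse order. -/
noncomputable def padMatrix (G : FinGraph) :
    Fin (G.n * G.n + 1 + G.n) → Fin (G.n * G.n + 1 + G.n) → Bool :=
  G.pad.revMatrix

theorem padMatrix_eq_true {G : FinGraph} {i p : Fin (G.n * G.n + 1 + G.n)} :
    G.padMatrix i p = true ↔ ∃ (hi : G.n * G.n + 1 + G.n - (i + 1) < G.n)
      (hp : G.n * G.n + 1 + G.n - (p + 1) < G.n),
      G.graph.Adj ⟨G.n * G.n + 1 + G.n - (i + 1), hi⟩ ⟨G.n * G.n + 1 + G.n - (p + 1), hp⟩ := by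
  classical
  exact decide_eq_true_iff

theorem padMatrix_bounds {G : FinGraph} {i p : Fin (G.n * G.n + 1 + G.n)}
    (h : G.padMatrix i p = true) : G.n * G.n + 1 ≤ (i : ℕ) ∧ G.n * G.n + 1 ≤ (p : ℕ) := by
  obtain ⟨hi, hp, -⟩ := padMatrix_eq_true.1 h
  omega

open Classical in
theorem padMatrix_natAdd (G : FinGraph) (i p : Fin G.n) :
    G.padMatrix (Fin.natAdd _ i) (Fin.natAdd _ p) = decide (G.graph.Adj i.rev p.rev) := by
  rw [Bool.eq_iff_iff, padMatrix_eq_true, decide_eq_true_iff]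
  have e : ∀ i : Fin G.n, G.n * G.n + 1 + G.n - ((Fin.natAdd (G.n * G.n + 1) i : ℕ) + 1) =
      (i.rev : ℕ) := by
    intro i
    rw [Fin.val_natAdd, Fin.val_rev]
    omega
  simp only [e, Fin.eta, Fin.is_lt, exists_true_left]

theorem _root_.List.flatMap_finRange_add {α : Type*} (δ n : ℕ) (f : Fin (δ + n) → List α)
    (h : ∀ i : Fin δ, f (Fin.castAdd n i) = []) :
    (List.finRange (δ + n)).flatMap f = (List.finRange n).flatMap fun i => f (Fin.natAdd δ i) := by
  rw [← List.ofFn_id, List.ofFn_add]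
  simp [List.flatMap_append, List.ofFn_eq_map, List.flatMap_map]
  exact h

/-- In reverse order the isolated vertices of `G.pad` come first, and deleting their rows and
columns leaves the reversed matrix of `G`. -/
theorem reverse_adjBits (G : FinGraph) :
    G.adjBits.reverse = (List.finRange (G.n * G.n + 1 + G.n)).flatMap fun i =>
      Turing.Expand.condensedRow (G.n * G.n + 1) G.padMatrix i
        (List.finRange (G.n * G.n + 1 + G.n)) := by
  classical
  rw [adjBits, List.reverse_flatMap, List.finRange_reverse, List.flatMap_map,
    List.flatMap_finRange_add]
  · congr 1
    funext i
    rw [Turing.Expand.condensedRow, List.flatMap_finRange_add]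
    · simp only [Function.comp_apply, ← List.map_reverse, List.finRange_reverse, List.map_map,
        Fin.val_natAdd, Nat.le_add_right, and_self, if_true, padMatrix_natAdd, ← List.map_eq_flatMap]
      rfl
    · intro p
      simp
      omega
  · intro i
    simp [Turing.Expand.condensedRow]
    omega

end FinGraph

/-! ### The regular graph and its hereditary properties -/

/-- The vertices that replace a vertex of a graph when it is made `d`-regular: `inl (i, j)` is a
copy of the vertex, and `inr (s, j)` is an additional vertex. -/
abbrev Cell (d : ℕ) : Type := (Fin d × Bool × Fin d) ⊕ (Fin d × Bool × Fin d)

/-- The adjacency between the vertices that replace `u` and those that replace `v`, where `adj`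
says that `u` and `v` are adjacent, `same` says that they are equal, and `deg` is the degree of
`u`. -/
def cellAdj (d : ℕ) (adj same : Prop) (deg : ℕ) : Cell d → Cell d → Prop
  | .inl (i, j), .inl (i', j') => adj ∧ i = i' ∧ j = j'
  | .inl (_, j), .inr (s, j') => same ∧ deg ≤ s ∧ j = j'
  | .inr (s, j), .inl (_, j') => same ∧ deg ≤ s ∧ j = j'
  | .inr (s, j), .inr (s', j') => same ∧ s = s' ∧ (s : ℕ) < deg ∧ j.1 ≠ j'.1

theorem Fin.card_filter_le_val (d n : ℕ) :
    (Finset.univ.filter fun s : Fin d => n ≤ s).card = d - n := by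
  rw [← Nat.card_Ico, ← Finset.card_map Fin.valEmbedding]
  congr 1
  ext s
  simp only [Finset.mem_map, Finset.mem_filter, Finset.mem_univ, true_and, Fin.valEmbedding_apply,
    Finset.mem_Ico]
  exact ⟨by rintro ⟨s, h, rfl⟩; exact ⟨h, s.2⟩, fun h => ⟨⟨s, h.2⟩, h.1, rfl⟩⟩

namespace SimpleGraph

variable {V : Type*} [Fintype V] (G : SimpleGraph V) (d : ℕ)

open Classical in
/-- A `d`-regular graph that consists of copies of a graph `G` of maximum degree at most `d` and of
additional vertices. An additional vertex is either adjacent to the vertices in `d` copies of a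
vertex of `G`, or lies in a complete bipartite graph. -/
noncomputable def regularize : SimpleGraph (V × Cell d) where
  Adj x y := cellAdj d (G.Adj x.1 y.1) (y.1 = x.1) (G.degree x.1) x.2 y.2
  symm := ⟨by
    rintro ⟨v, ⟨i, j⟩ | ⟨s, j⟩⟩ ⟨u, ⟨i', j'⟩ | ⟨s', j'⟩⟩ h
    · exact ⟨h.1.symm, h.2.1.symm, h.2.2.symm⟩
    · obtain ⟨rfl, h2, rfl⟩ := h
      exact ⟨rfl, h2, rfl⟩
    · obtain ⟨rfl, h2, rfl⟩ := h
      exact ⟨rfl, h2, rfl⟩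
    · obtain ⟨rfl, rfl, h2, h3⟩ := h
      exact ⟨rfl, rfl, h2, h3.symm⟩⟩
  loopless := ⟨by
    rintro ⟨v, ⟨i, j⟩ | ⟨s, j⟩⟩ h
    · exact G.irrefl h.1
    · exact h.2.2.2 rfl⟩

variable {G d}

open Classical in
theorem regularize_adj {x y : V × Cell d} : (G.regularize d).Adj x y ↔
    cellAdj d (G.Adj x.1 y.1) (y.1 = x.1) (G.degree x.1) x.2 y.2 :=
  Iff.rfl

open Classical in
-- A copy of `v` has `deg v` neighbours in its own copy of `G` and one for each index `s` with `deg
-- v ≤ s < d`. An additional vertex sees either the `d` copies of `v` in its group or the opposite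
-- side of a `K_{d,d}`.
theorem regularize_isRegularOfDegree (h : ∀ v, G.degree v ≤ d) :
    (G.regularize d).IsRegularOfDegree d := by
  rintro ⟨v, ⟨i, j⟩ | ⟨s, j⟩⟩
  · have e : (G.regularize d).neighborFinset (v, .inl (i, j)) =
        (G.neighborFinset v).image (fun u => ((u, .inl (i, j)) : V × Cell d)) ∪
        (Finset.univ.filter fun s : Fin d => G.degree v ≤ s).image
          fun s => ((v, .inr (s, j)) : V × Cell d) := by
      ext ⟨u, ⟨i', j'⟩ | ⟨s, j'⟩⟩ <;>
        simp [regularize_adj, cellAdj, and_comm, eq_comm]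
      tauto
    rw [← card_neighborFinset_eq_degree, e, Finset.card_union_of_disjoint,
      Finset.card_image_of_injective _ fun a b hab => (Prod.ext_iff.1 hab).1,
      Finset.card_image_of_injective _ fun a b hab => by simpa using hab,
      card_neighborFinset_eq_degree]
    · have := h v
      rw [Fin.card_filter_le_val]
      omega
    · rw [Finset.disjoint_left]
      simp
  · by_cases hs : G.degree v ≤ s
    · have e : (G.regularize d).neighborFinset (v, .inr (s, j)) =
          Finset.univ.image fun i : Fin d => ((v, .inl (i, j)) : V × Cell d) := by
        ext ⟨u, ⟨i', j'⟩ | ⟨s, j'⟩⟩ <;>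
        simp [regularize_adj, cellAdj, and_comm, eq_comm, hs]
      rw [← card_neighborFinset_eq_degree, e,
        Finset.card_image_of_injective _ fun a b hab => by simpa using hab, Finset.card_univ,
        Fintype.card_fin]
    · have e : (G.regularize d).neighborFinset (v, .inr (s, j)) =
          Finset.univ.image fun t : Fin d => ((v, .inr (s, !j.1, t)) : V × Cell d) := by
        ext ⟨u, ⟨i', j'⟩ | ⟨s, b, j'⟩⟩ <;>
        simp [regularize_adj, cellAdj, and_comm, eq_comm, Nat.lt_of_not_le hs]
        cases b <;> cases j.1 <;> simp
      rw [← card_neighborFinset_eq_degree, e,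
        Finset.card_image_of_injective _ fun a b hab => by simpa using hab, Finset.card_univ,
        Fintype.card_fin]

theorem regularize_cliqueFree (h : G.CliqueFree 3) : (G.regularize d).CliqueFree 3 := by
  classical
  have hb : ∀ a b c : Bool, a ≠ b → a ≠ c → b = c := by decide
  have key : ∀ x y z, (G.regularize d).Adj x y → (G.regularize d).Adj x z →
      (G.regularize d).Adj y z → False := by
    rintro ⟨v, ⟨i, j⟩ | ⟨s, j⟩⟩ ⟨u, ⟨i', j'⟩ | ⟨s', j'⟩⟩ ⟨w, ⟨i'', j''⟩ | ⟨s'', j''⟩⟩ h1 h2 h3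
    · exact h {v, u, w} (is3Clique_iff.2 ⟨v, u, w, h1.1, h2.1, h3.1, rfl⟩)
    -- A triangle with two copies and an additional vertex would make a vertex of `G` adjacent to
    -- itself; a copy and two additional vertices would need both `deg ≤ s` and `s < deg`; three
    -- additional vertices would need three distinct Booleans.
    all_goals
      simp only [regularize, cellAdj] at h1 h2 h3
      have := G.irrefl (v := v)
      have := G.irrefl (v := u)
      have := hb j.1 j'.1 j''.1
      grind
  intro s hs
  obtain ⟨x, y, z, h1, h2, h3, -⟩ := is3Clique_iff.1 hs
  exact key x y z h1 h2 h3

theorem regularize_isBipartite (h : G.IsBipartite) : (G.regularize d).IsBipartite := by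
  classical
  obtain ⟨c⟩ := h
  have hne : ∀ a : Fin 2, a ≠ a + 1 := by decide
  -- All neighbours of an additional vertex with `deg v ≤ s` are copies of the same vertex `v`, so
  -- the other colour is free for it.
  refine ⟨Coloring.mk (fun x => match x with
    | (v, .inl _) => c v
    | (v, .inr (s, j)) => if G.degree v ≤ s then c v + 1 else if j.1 then 1 else 0) ?_⟩
  rintro ⟨v, ⟨i, j⟩ | ⟨s, b, j⟩⟩ ⟨u, ⟨i', j'⟩ | ⟨s', b', j'⟩⟩ h
  · exact c.valid h.1
  · obtain ⟨rfl, h2, -⟩ := h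
    simp only at h2 ⊢
    rw [if_pos h2]
    exact hne _
  · obtain ⟨rfl, h2, -⟩ := h
    simp only at h2 ⊢
    rw [if_pos h2]
    exact (hne _).symm
  · obtain ⟨rfl, rfl, h2, h3⟩ := h
    simp only at h2 h3 ⊢
    simp only [if_neg (show ¬ G.degree u ≤ s by omega)]
    cases b <;> cases b' <;> simp at h3 ⊢

end SimpleGraph

/-! ### Star colourings of the regular graph -/

theorem IsStarColourable.of_injective_hom {V W : Type*} {G : SimpleGraph V} {H : SimpleGraph W}
    {k : ℕ} (h : IsStarColourable H k) (φ : G →g H) (hφ : Function.Injective φ) :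
    IsStarColourable G k := by
  obtain ⟨f, hf⟩ := h
  refine ⟨f.comp φ, fun u v w x hn h1 h2 h3 => ?_⟩
  exact hf (φ u) (φ v) (φ w) (φ x) (by simpa using hn.map hφ) (φ.map_adj h1) (φ.map_adj h2)
    (φ.map_adj h3)

namespace SimpleGraph

variable {V : Type*} [Fintype V] {G : SimpleGraph V} {d k : ℕ}

theorem isStarColourable_of_regularize (hd : 0 < d) (h : IsStarColourable (G.regularize d) k) :
    IsStarColourable G k :=
  h.of_injective_hom ⟨fun v => (v, .inl (⟨0, hd⟩, false, ⟨0, hd⟩)), fun h => ⟨h, rfl, rfl⟩⟩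
    fun _ _ h => (Prod.ext_iff.1 h).1

open Classical in
/-- If `d < k`, then there are enough colours that neither occur at `v` nor at a neighbour. -/
theorem exists_new_colours (hdk : d < k) (f : G.Coloring (Fin k)) (v : V) :
    ∃ g : Fin d → Fin k, ∀ s : Fin d, G.degree v ≤ s →
      g s ≠ f v ∧ (∀ u, G.Adj v u → g s ≠ f u) ∧
        ∀ s' : Fin d, G.degree v ≤ s' → g s = g s' → s = s' := by
  set U : Finset (Fin k) := insert (f v) ((G.neighborFinset v).image f)
  have hU : U.card ≤ G.degree v + 1 :=
    (Finset.card_insert_le _ _).trans (Nat.succ_le_succ Finset.card_image_le)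
  -- At least `k - (deg v + 1)` colours are free, and this is at least `d - deg v` because `d < k`.
  have hc : Fintype.card {s : Fin d // G.degree v ≤ s} ≤ Fintype.card {c : Fin k // c ∉ U} := by
    rw [Fintype.card_subtype, Fin.card_filter_le_val, Fintype.card_subtype_compl, Fintype.card_fin,
      Fintype.card_coe]
    omega
  obtain ⟨e⟩ := Function.Embedding.nonempty_of_card_le hc
  refine ⟨fun s => if h : G.degree v ≤ s then (e ⟨s, h⟩ : Fin k) else f v, fun s hs => ?_⟩
  have h1 := (e ⟨s, hs⟩).2
  simp only [U, Finset.mem_insert, Finset.mem_image, mem_neighborFinset, not_or, not_exists,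
    not_and] at h1
  simp only [dif_pos hs]
  refine ⟨h1.1, fun u hu h2 => h1.2 u hu h2.symm, fun s' hs' h2 => ?_⟩
  rw [dif_pos hs'] at h2
  simpa using e.injective (Subtype.ext h2)

open Classical in
-- Each edge at an additional vertex has an end at which the colour of the other end occurs on only
-- one neighbour: the copy, or the `false` side of a `K_{d,d}`. Such an edge is not the middle of a
-- bicoloured path.
theorem regularize_isStarColourable (hdk : d < k) (h : IsStarColourable G k) :
    IsStarColourable (G.regularize d) k := by
  obtain ⟨f, hf⟩ := h
  choose g hg using exists_new_colours (d := d) hdk f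
  -- In a `K_{d,d}`, one side gets colour `0` and the other the distinct colours `1, …, d`,
  -- available because `d < k`.
  let c : V × Cell d → Fin k := fun x => match x with
    | (v, .inl _) => f v
    | (v, .inr (s, b, j)) =>
      if G.degree v ≤ s then g v s else if b then ⟨j + 1, by omega⟩ else ⟨0, by omega⟩
  have c_copy : ∀ v a, c (v, .inl a) = f v := fun _ _ => rfl
  have c_slot : ∀ v (s : Fin d) j, G.degree v ≤ s → c (v, .inr (s, j)) = g v s := fun v s j h => if_pos h
  have c_false : ∀ v (s : Fin d) j, ¬ G.degree v ≤ s →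
      c (v, .inr (s, false, j)) = ⟨0, by omega⟩ := fun v s j h => by simp [c, h]
  have c_true : ∀ v (s : Fin d) j, ¬ G.degree v ≤ s →
      c (v, .inr (s, true, j)) = ⟨j + 1, by omega⟩ := fun v s j h => by simp [c, h]
  clear_value c
  have hc : ∀ {x y}, (G.regularize d).Adj x y → c x ≠ c y := by
    rintro ⟨v, ⟨i, j⟩ | ⟨s, b, j⟩⟩ ⟨u, ⟨i', j'⟩ | ⟨s', b', j'⟩⟩ h
    · rw [c_copy, c_copy]
      exact f.valid h.1
    · obtain ⟨hu, h2, -⟩ := h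
      simp only at hu h2
      subst hu
      rw [c_copy, c_slot _ _ _ h2]
      exact (hg _ _ h2).1.symm
    · obtain ⟨hu, h2, -⟩ := h
      simp only at hu h2
      subst hu
      rw [c_copy, c_slot _ _ _ h2]
      exact (hg _ _ h2).1
    · obtain ⟨rfl, rfl, h2, h3⟩ := h
      simp only at h2 h3
      cases b <;> cases b' <;> simp at h3
      · rw [c_false _ _ _ (by simpa using h2), c_true _ _ _ (by simpa using h2)]; simp
      · rw [c_false _ _ _ (by simpa using h2), c_true _ _ _ (by simpa using h2)]; simp
  -- a neighbour of a copy of a vertex does not share the colour of another neighbour that is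
  -- an additional vertex
  have key₁ : ∀ v i j (s : Fin d) x, G.degree v ≤ s → (G.regularize d).Adj (v, .inl (i, j)) x →
      c x = g v s → x = (v, .inr (s, j)) := by
    rintro v i j s ⟨u, ⟨i', j'⟩ | ⟨s', j'⟩⟩ hs hx hcx
    · rw [c_copy] at hcx
      exact absurd hcx.symm ((hg v s hs).2.1 u hx.1)
    · obtain ⟨hu, hx2, rfl⟩ := hx
      obtain rfl : u = v := hu
      rw [c_slot _ _ _ hx2] at hcx
      rw [(hg u s hs).2.2 s' hx2 hcx.symm]
  have key₂ : ∀ v (s : Fin d) j t x, ¬ G.degree v ≤ s →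
      (G.regularize d).Adj (v, .inr (s, false, j)) x →
      c x = c (v, .inr (s, true, t)) → x = (v, .inr (s, true, t)) := by
    rintro v s j t ⟨u, ⟨i', j'⟩ | ⟨s', b', j'⟩⟩ hs hx hcx
    · exact absurd hx.2.1 hs
    · obtain ⟨hu, rfl, -, hb⟩ := hx
      obtain rfl : u = v := hu
      obtain rfl : b' = true := by simpa using hb.symm
      rw [c_true _ _ _ hs, c_true _ _ _ hs] at hcx
      simp only [Fin.mk.injEq, Nat.add_right_cancel_iff] at hcx
      rw [Fin.ext hcx]
  refine ⟨Coloring.mk c hc, ?_⟩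
  rintro u v w x hn huv hvw hwx ⟨h1, h2⟩
  change c u = c w at h1
  change c v = c x at h2
  have huw : u ≠ w := by rintro rfl; simp at hn
  have hvx : v ≠ x := by rintro rfl; simp at hn
  -- The cases are the types of the middle edge. Between two copies, either the path stays in one
  -- copy of `G`, or an end is an additional vertex, whose colour avoids the closed neighbourhood of
  -- its base vertex.
  obtain ⟨v, ⟨i, j⟩ | ⟨s, b, j⟩⟩ := v <;> obtain ⟨w, ⟨i', j'⟩ | ⟨s', b', j'⟩⟩ := w
  · obtain ⟨h3, h4, h5⟩ := hvw
    simp only at h3 h4 h5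
    subst h4 h5
    obtain ⟨u, ⟨iu, ju⟩ | ⟨su, ju⟩⟩ := u
    · obtain ⟨x, ⟨ix, jx⟩ | ⟨sx, jx⟩⟩ := x
      · obtain ⟨h6, h7, h8⟩ := huv
        obtain ⟨h9, h10, h11⟩ := hwx
        simp only at h6 h7 h8 h9 h10 h11
        subst h7 h8 h10 h11
        rw [c_copy, c_copy] at h1 h2
        refine hf u v w x ?_ h6 h3 h9 ⟨h1, h2⟩
        simpa using hn
      · obtain ⟨hx, h4, -⟩ := hwx
        simp only at hx h4
        subst hx
        rw [c_slot _ _ _ h4, c_copy] at h2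
        exact (hg _ _ h4).2.1 v h3.symm h2.symm
    · obtain ⟨hu, h4, -⟩ := huv
      simp only at hu h4
      subst hu
      rw [c_slot _ _ _ h4, c_copy] at h1
      exact (hg _ _ h4).2.1 w h3 h1
  · obtain ⟨hw, h4, h5⟩ := hvw
    obtain rfl : w = v := hw
    simp only at h4 h5
    subst h5
    rw [c_slot _ _ _ h4] at h1
    exact huw (key₁ _ _ _ _ _ h4 huv.symm h1)
  · obtain ⟨hw, h4, h5⟩ := hvw
    obtain rfl : w = v := hw
    simp only at h4 h5
    subst h5
    rw [c_slot _ _ _ h4] at h2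
    exact hvx (key₁ _ _ _ _ _ h4 hwx h2.symm).symm
  · obtain ⟨hw, h4, h5, h6⟩ := hvw
    obtain rfl : w = v := hw
    simp only at h4 h5 h6
    subst h4
    cases b <;> cases b' <;> simp at h6
    · exact huw (key₂ _ _ _ _ _ (by omega) huv.symm h1)
    · exact hvx (key₂ _ _ _ _ _ (by omega) hwx h2.symm).symm

end SimpleGraph

/-! ### Padding and regularization of instances -/

namespace FinGraph

variable (G : FinGraph) {d k m : ℕ}

/-- The inclusion of a graph into the graph with additional isolated vertices. -/
def toPad : G.graph →g G.pad.graph where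
  toFun v := ⟨v, lt_of_lt_of_le v.2 (Nat.le_add_left _ _)⟩
  map_rel' h := ⟨_, _, h⟩

theorem toPad_injective : Function.Injective G.toPad := fun _ _ h =>
  Fin.ext (Fin.mk.inj_iff.1 h)

/-- The map from a graph with additional isolated vertices to the graph itself. -/
def ofPad : G.pad.graph →g G.graph where
  -- The image of the isolated vertices is irrelevant, as they lie on no edge; the map is injective
  -- on the remaining vertices.
  toFun v := if h : (v : ℕ) < G.n then ⟨v, h⟩ else ⟨0, G.n_pos⟩
  map_rel' := by
    rintro u v ⟨hu, hv, h⟩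
    simpa [hu, hv] using h

theorem ofPad_apply {v : Fin G.pad.n} (h : (v : ℕ) < G.n) : G.ofPad v = ⟨v, h⟩ :=
  dif_pos h

theorem ofPad_injOn {u v : Fin G.pad.n} (hu : (u : ℕ) < G.n) (hv : (v : ℕ) < G.n)
    (h : G.ofPad u = G.ofPad v) : u = v := by
  rw [G.ofPad_apply hu, G.ofPad_apply hv] at h
  exact Fin.ext (Fin.mk.inj_iff.1 h)

variable {G}

open Classical in
theorem pad_degree_le (h : ∀ v, G.graph.degree v ≤ d) (v : Fin G.pad.n) :
    G.pad.graph.degree v ≤ d := by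
  refine le_trans ?_ (h (G.ofPad v))
  rw [← SimpleGraph.card_neighborFinset_eq_degree, ← SimpleGraph.card_neighborFinset_eq_degree]
  refine Finset.card_le_card_of_injOn G.ofPad ?_ ?_
  · intro u hu
    simp only [Finset.mem_coe, SimpleGraph.mem_neighborFinset] at hu ⊢
    exact G.ofPad.map_adj hu
  · intro u hu w hw
    simp only [Finset.mem_coe, SimpleGraph.mem_neighborFinset] at hu hw
    exact G.ofPad_injOn hu.2.1 hw.2.1

theorem IsTriangleFree.pad (h : G.IsTriangleFree) : G.pad.IsTriangleFree := by
  classical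
  intro s hs
  obtain ⟨x, y, z, h1, h2, h3, -⟩ := SimpleGraph.is3Clique_iff.1 hs
  exact h _ (SimpleGraph.is3Clique_iff.2 ⟨_, _, _, G.ofPad.map_adj h1, G.ofPad.map_adj h2,
    G.ofPad.map_adj h3, rfl⟩)

theorem IsBipartite.pad (h : G.IsBipartite) : G.pad.IsBipartite :=
  SimpleGraph.Colorable.of_hom G.ofPad h

theorem pad_isStarColourable :
    IsStarColourable G.pad.graph k ↔ IsStarColourable G.graph k := by
  refine ⟨fun h => h.of_injective_hom G.toPad G.toPad_injective, ?_⟩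
  rintro ⟨f, hf⟩
  refine ⟨f.comp G.ofPad, fun u v w x hn h1 h2 h3 => ?_⟩
  refine hf _ _ _ _ (List.Nodup.map_on (f := G.ofPad) ?_ hn) (G.ofPad.map_adj h1)
    (G.ofPad.map_adj h2) (G.ofPad.map_adj h3)
  have hlt : ∀ y ∈ [u, v, w, x], (y : ℕ) < G.n := by
    simp only [List.mem_cons, List.not_mem_nil, or_false, forall_eq_or_imp, forall_eq]
    exact ⟨h1.1, h1.2.1, h3.1, h3.2.1⟩
  exact fun y hy z hz => G.ofPad_injOn (hlt y hy) (hlt z hz)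

/-- The enumeration of the vertices of the regularization of a graph. -/
def regularizeEquiv (G : FinGraph) (ε : Fin (m + 1) ≃ Cell d) :
    Fin (G.n * (m + 1)) ≃ Fin G.n × Cell d :=
  finProdFinEquiv.symm.trans (Equiv.prodCongr (Equiv.refl _) ε)

/-- The regularization of a graph on an initial segment of the natural numbers. -/
noncomputable def regularize (G : FinGraph) (ε : Fin (m + 1) ≃ Cell d) : FinGraph where
  n := G.n * (m + 1)
  n_pos := Nat.mul_pos G.n_pos m.succ_pos
  graph := (G.graph.regularize d).comap (G.regularizeEquiv ε)

/-- The isomorphism between the two versions of the regularization of a graph. -/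
noncomputable def regularizeIso (G : FinGraph) (ε : Fin (m + 1) ≃ Cell d) :
    (G.regularize ε).graph ≃g G.graph.regularize d :=
  SimpleGraph.Iso.comap (G.regularizeEquiv ε) _

variable {ε : Fin (m + 1) ≃ Cell d}

open Classical in
theorem regularize_isRegular (h : ∀ v, G.graph.degree v ≤ d) : (G.regularize ε).IsRegular d := by
  intro v
  rw [← (G.regularizeIso ε).degree_eq]
  exact SimpleGraph.regularize_isRegularOfDegree h _

theorem IsTriangleFree.regularize (h : G.IsTriangleFree) : (G.regularize ε).IsTriangleFree :=
  (SimpleGraph.regularize_cliqueFree h).comap ⟨(G.regularizeIso ε).toCopy⟩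

theorem IsBipartite.regularize (h : G.IsBipartite) : (G.regularize ε).IsBipartite :=
  SimpleGraph.Colorable.of_hom (G.regularizeIso ε).toHom (SimpleGraph.regularize_isBipartite h)

theorem regularize_isStarColourable (hd : 0 < d) (hdk : d < k) :
    IsStarColourable (G.regularize ε).graph k ↔ IsStarColourable G.graph k := by
  constructor
  · intro h
    exact SimpleGraph.isStarColourable_of_regularize hd (h.of_injective_hom
      (G.regularizeIso ε).symm.toHom (G.regularizeIso ε).symm.injective)
  · intro h
    exact (SimpleGraph.regularize_isStarColourable hdk h).of_injective_hom
      (G.regularizeIso ε).toHom (G.regularizeIso ε).injective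

open Classical in
/-- The table that computes the adjacency matrix of the regularization of a graph. -/
noncomputable def regularizeTable (ε : Fin (m + 1) ≃ Cell d) (x y : Bool) (deg : Fin (d + 1))
    (a b : Fin (m + 1)) : Bool :=
  decide (cellAdj d (x = true) (y = true) deg (ε a.rev) (ε b.rev))

open Classical in
theorem encode_regularize_pad (h : ∀ v, G.graph.degree v ≤ d) :
    (G.pad.regularize ε).encode = List.replicate ((G.n * G.n + 1 + G.n) * (m + 1)) true ++
      false :: (Turing.Expand.expansion (regularizeTable ε) G.padMatrix).reverse := by
  have := adjBits_eq_expansion (fun x y deg a b => regularizeTable ε x y deg a.rev b.rev) G.pad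
    (G.pad.regularize ε).graph (G.pad.regularize ε).n_pos ?_
  · simp only [Fin.rev_rev] at this
    exact congrArg (fun l => List.replicate ((G.n * G.n + 1 + G.n) * (m + 1)) true ++ false :: l)
      this
  · intro u v a b
    -- The machine counts degrees modulo `d + 1`, which loses nothing when all degrees are at most
    -- `d`.
    have hdeg : ((Fin.ofNat (d + 1) (G.pad.graph.degree u) : Fin (d + 1)) : ℕ) =
        G.pad.graph.degree u :=
      Nat.mod_eq_of_lt (Nat.lt_succ_of_le (pad_degree_le h u))
    simp only [regularizeTable, Fin.rev_rev, hdeg, decide_eq_true_eq]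
    simp only [regularize, SimpleGraph.comap_adj, regularizeEquiv, Equiv.trans_apply,
      Equiv.symm_apply_apply]
    exact SimpleGraph.regularize_adj

theorem encode_length : G.encode.length = G.n * G.n + 1 + G.n := by
  simp [encode, adjBits_length]
  omega

theorem encode_regularize_pad_length : (G.pad.regularize ε).encode.length =
    (G.encode.length * (m + 1)) * (G.encode.length * (m + 1)) + 1 + G.encode.length * (m + 1) := by
  rw [encode_length, encode_length]
  rfl

open Classical in
theorem nonempty_regularize_pad_computable {A α β : Type} [Fintype A] {sym : Bool → A}
    {read : A → Option Bool} (hsym : ∀ b, read (sym b) = some b) (ε : Fin (m + 1) ≃ Cell d)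
    {ea : α → List A} {eb : β → List A} {f : α → β} (g : α → FinGraph) (t : α → List A)
    (ht : ∀ x, (t x).head?.bind read = none)
    (hg : ∀ x v, (g x).graph.degree v ≤ d) (ha : ∀ x, ea x = (g x).encode.map sym ++ t x)
    (hb : ∀ x, eb (f x) = ((g x).pad.regularize ε).encode.map sym ++ t x) :
    Nonempty (Turing.TM2ComputableInPolyTime ea eb f) :=
  Turing.nonempty_expand_computable hsym (regularizeTable ε) fun x =>
    ⟨(g x).n, _, (g x).padMatrix, (g x).adjBits, t x, (g x).n_pos,
      fun _ _ => padMatrix_bounds, by rw [adjBits_length], reverse_adjBits _, ht x, ha x,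
      by rw [hb, encode_regularize_pad (hg x)]⟩

end FinGraph

/-! ### Transfer of NP-completeness -/

/-- A machine that computes a function also computes the functions that agree with it on codes. -/
def Turing.TM2ComputableInPolyTime.ofEncodeEq {α α' β β' Γ Γ' : Type} {ea : α → List Γ}
    {ea' : α' → List Γ} {eb : β → List Γ'} {eb' : β' → List Γ'} {f : α → β}
    (h : TM2ComputableInPolyTime ea eb f) (f' : α' → β') (g : α' → α)
    (ha : ∀ x, ea' x = ea (g x)) (hb : ∀ x, eb' (f' x) = eb (f (g x))) :
    TM2ComputableInPolyTime ea' eb' f' where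
  toTM2ComputableAux := h.toTM2ComputableAux
  time := h.time
  outputsFun x := by
    rw [ha, hb]
    exact h.outputsFun (g x)

open DecisionProblem

open Classical in
theorem StarColourability.restrict_npComplete_iff {k d : ℕ} (hd : 0 < d) (hdk : d < k)
    {C C' : FinGraph → Prop} (hC : ∀ G, C' G → C G) (hdeg : ∀ G, C G → ∀ v, G.graph.degree v ≤ d)
    (hreg : ∀ (G : FinGraph) (m : ℕ) (ε : Fin (m + 1) ≃ Cell d), C G → C' (G.pad.regularize ε)) :
    ((StarColourability k).restrict C).NPComplete ↔
      ((StarColourability k).restrict C').NPComplete := by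
  obtain ⟨m, ⟨ε⟩⟩ : ∃ m, Nonempty (Fin (m + 1) ≃ Cell d) := by
    have : 0 < Fintype.card (Cell d) :=
      Fintype.card_pos_iff.2 ⟨.inl (⟨0, hd⟩, false, ⟨0, hd⟩)⟩
    exact ⟨Fintype.card (Cell d) - 1, ⟨(Fintype.equivFinOfCardEq (by omega)).symm⟩⟩
  let incl : {G // C' G} → {G // C G} := fun G => ⟨G.1, hC _ G.2⟩
  let red : {G // C G} → {G // C' G} := fun G => ⟨G.1.pad.regularize ε, hreg _ _ _ G.2⟩
  have hred : ∀ G : {G // C G}, ((StarColourability k).restrict C).Yes G ↔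
      ((StarColourability k).restrict C').Yes (red G) := fun G =>
    (FinGraph.pad_isStarColourable.symm.trans
      (FinGraph.regularize_isStarColourable hd hdk).symm)
  constructor
  · rintro ⟨⟨p, verify, ⟨h⟩, hp⟩, hL⟩
    refine ⟨⟨p, fun y => verify (incl y.1, y.2),
      ⟨h.ofEncodeEq _ (fun y => (incl y.1, y.2)) (fun _ => rfl) fun _ => rfl⟩,
      fun x => hp (incl x)⟩, fun L hL' => ?_⟩
    obtain ⟨f, ⟨hf⟩, hf'⟩ := hL L hL'
    obtain ⟨hr⟩ := FinGraph.nonempty_regularize_pad_computable (A := Bool) (sym := id)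
      (read := some) (fun _ => rfl) ε (ea := ((StarColourability k).restrict C).encode)
      (eb := ((StarColourability k).restrict C').encode) (f := red) (fun G => G.1) (fun _ => [])
      (fun _ => rfl) (fun G => hdeg _ G.2) (fun G => by simp [DecisionProblem.restrict, StarColourability])
      (fun G => by simp [DecisionProblem.restrict, StarColourability, red])
    exact ⟨red ∘ f, hf.nonempty_comp hr, fun x => (hf' x).trans (hred _)⟩
  · rintro ⟨⟨p, verify, ⟨h⟩, hp⟩, hL⟩
    refine ⟨⟨p.comp ((Polynomial.X * Polynomial.C (m + 1)) * (Polynomial.X * Polynomial.C (m + 1)) +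
      1 + Polynomial.X * Polynomial.C (m + 1)), fun y => verify (red y.1, y.2), ?_, fun x => ?_⟩,
      fun L hL' => ?_⟩
    -- The verifier regularizes the graph and keeps the certificate. The symbol `none` is not a bit,
    -- so the expansion machine stops reading there.
    · obtain ⟨hr⟩ := FinGraph.nonempty_regularize_pad_computable (A := Option Bool) (sym := some)
        (read := id) (fun _ => rfl) ε
        (ea := ((StarColourability k).restrict C).encodeWithCertificate)
        (eb := ((StarColourability k).restrict C').encodeWithCertificate)
        (f := fun y => (red y.1, y.2)) (fun y => y.1.1) (fun y => none :: y.2.map some)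
        (fun _ => rfl) (fun y => hdeg _ y.1.2) (fun _ => rfl) (fun _ => rfl)
      exact hr.nonempty_comp h
    · refine ((hred x).trans (hp (red x))).trans ?_
      have e : (((StarColourability k).restrict C').encode (red x)).length = _ :=
        FinGraph.encode_regularize_pad_length (G := x.1) (ε := ε)
      rw [e]
      simp [DecisionProblem.restrict, StarColourability]
    · obtain ⟨f, ⟨hf⟩, hf'⟩ := hL L hL'
      exact ⟨incl ∘ f, ⟨hf.ofEncodeEq _ id (fun _ => rfl) fun _ => rfl⟩, hf'⟩

namespace FinGraph

open Classical in
theorem IsRegular.hasMaxDegree {G : FinGraph} {d : ℕ} (h : G.IsRegular d) : G.HasMaxDegree d := by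
  have : Nonempty (Fin G.n) := ⟨⟨0, G.n_pos⟩⟩
  exact SimpleGraph.IsRegularOfDegree.maxDegree_eq _ h

open Classical in
theorem HasMaxDegree.degree_le {G : FinGraph} {d : ℕ} (h : G.HasMaxDegree d) (v : Fin G.n) :
    G.graph.degree v ≤ d :=
  (G.graph.degree_le_maxDegree v).trans_eq h

theorem hasMaxDegree_zero_iff {G : FinGraph} : G.HasMaxDegree 0 ↔ G.IsRegular 0 :=
  ⟨fun h v => Nat.le_zero.1 (h.degree_le v), fun h => h.hasMaxDegree⟩

theorem HasMaxDegree.isRegular_regularize_pad {G : FinGraph} {d m : ℕ} (h : G.HasMaxDegree d)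
    (ε : Fin (m + 1) ≃ Cell d) : (G.pad.regularize ε).IsRegular d :=
  regularize_isRegular (pad_degree_le h.degree_le)

end FinGraph

theorem mainTheorem5 (k d : ℕ) (hk : 3 ≤ k) (hd : d ≤ k - 1) :
    (((StarColourability k).restrict fun G : FinGraph => G.HasMaxDegree d).NPComplete ↔
      ((StarColourability k).restrict fun G : FinGraph => G.IsRegular d).NPComplete) ∧
    (((StarColourability k).restrict fun G : FinGraph =>
        G.IsTriangleFree ∧ G.HasMaxDegree d).NPComplete ↔
      ((StarColourability k).restrict fun G : FinGraph =>
        G.IsTriangleFree ∧ G.IsRegular d).NPComplete) ∧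
    (((StarColourability k).restrict fun G : FinGraph =>
        G.IsBipartite ∧ G.HasMaxDegree d).NPComplete ↔
      ((StarColourability k).restrict fun G : FinGraph =>
        G.IsBipartite ∧ G.IsRegular d).NPComplete) := by
  -- For `d = 0` the type `Cell d` is empty and the construction fails, but the two classes
  -- coincide.
  rcases Nat.eq_zero_or_pos d with rfl | hd0
  · have h : FinGraph.HasMaxDegree 0 = FinGraph.IsRegular 0 :=
      funext fun _ => propext FinGraph.hasMaxDegree_zero_iff
    rw [h]
    exact ⟨Iff.rfl, Iff.rfl, Iff.rfl⟩
  · have hdk : d < k := by omega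
    exact ⟨StarColourability.restrict_npComplete_iff hd0 hdk
        (fun _ h => h.hasMaxDegree) (fun _ h => h.degree_le)
        fun _ _ ε h => h.isRegular_regularize_pad ε,
      StarColourability.restrict_npComplete_iff hd0 hdk
        (fun _ h => ⟨h.1, h.2.hasMaxDegree⟩) (fun _ h => h.2.degree_le)
        fun _ _ ε h => ⟨h.1.pad.regularize, h.2.isRegular_regularize_pad ε⟩,
      StarColourability.restrict_npComplete_iff hd0 hdk
        (fun _ h => ⟨h.1, h.2.hasMaxDegree⟩) (fun _ h => h.2.degree_le)
        fun _ _ ε h => ⟨h.1.pad.regularize, h.2.isRegular_regularize_pad ε⟩⟩
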